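/- Let $K$ be an infinite field of characteristic $p>0$, let $n\ge r$ be positive integers, let $V=K^n$ and let $S=S_K(n,r)$ be the Schur algebra, i.e. the algebra of $K$-endomorphisms of $V^{\otimes r}$ that commute with the place permutations. For a partition $\lambda$ of $r$ with at most $n$ parts let $\Delta(\lambda)$ be the Weyl $S$-module, i.e. the image of the map $d'_\lambda : D_{\lambda_1}V\otimes D_{\lambda_2}V\otimes\cdots\to\Lambda^{\lambda^t_1}V\otimes\Lambda^{\lambda^t_2}V\otimes\cdots$ (with $\lambda^t$ the transpose of $\lambda$) that diagonalises the divided powers along the rows of the diagram of $\lambda$ and multiplies in the exterior algebra along its columns. For integers $x\ge 1$ and $y\ge 1$ put \[R(x,y)=\gcd\left\{\tbinom{x}{1},\tbinom{x+1}{2},\dots,\tbinom{x+y-1}{y}\right\},\] and put $R(x,0)=0$. Corollary 6.2. Let $\lambda=(\lambda_1,\dots,\lambda_m)$ and $\mu=(\mu_1,\mu_2)$ be partitions of $r$ with at most $n$ parts, where $m\ge 3$, $\lambda_m\neq 0$ and $\mu_2\le\lambda_1$. Set $d=\mu_1-\lambda_1$ and assume $0<d\le\lambda_2-\lambda_3$.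 Suppose that $p$ divides all of the following integers: (1) $R(\lambda_1-\mu_2+1,\,d)$, (2) $R(\lambda_i+1,\,\lambda_{i+1})$ for $i=2,\dots,m-1$, (3) $R(\lambda_1-\lambda_2+d+1,\,d)$, (4) $R(\lambda_2-d+1,\,\lambda_3)$. Then $\dim_K \operatorname{Hom}_S(\Delta(\lambda),\Delta(\mu))\ge 2$. -/

import Mathlib

open scoped TensorProduct

/-- `∧⁺(n,r)`: partitions of `r` with at most `n` parts, extended by zero to a sequence.
Indexing starts at `0`, so `part i` is the part usually written `λ_{i+1}`. -/
structure PartitionOf (n r : ℕ) where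
  /-- `part i` is `λ_{i+1}`. -/
  part : ℕ → ℕ
  antitone : Antitone part
  part_eq_zero : ∀ i, n ≤ i → part i = 0
  sum_eq : ∑ i : Fin n, part i = r

/-- `R(x,y) = gcd { binom(x,1), binom(x+1,2), …, binom(x+y-1,y) }`, with `R(x,0) = 0`. -/
def binomGcd (x y : ℕ) : ℕ :=
  (Finset.Icc 1 y).gcd fun i => (x + i - 1).choose i

noncomputable section

section TensorSpace

variable (K : Type*) [Field K] (n r : ℕ)

/-- `V^{⊗ r}` for the natural module `V = Kⁿ`. -/
def TensorSpace : Type _ := ⨂[K] _ : Fin r, (Fin n → K)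

instance : AddCommGroup (TensorSpace K n r) :=
  inferInstanceAs (AddCommGroup (⨂[K] _ : Fin r, (Fin n → K)))

instance : Module K (TensorSpace K n r) :=
  PiTensorProduct.instModule (R := K) (s := fun _ : Fin r => (Fin n → K))

/-- `TensorSpace K n r` is Mathlib's tensor power, with the same operations. -/
def tensorSpaceEquiv : (⨂[K] _ : Fin r, (Fin n → K)) ≃ₗ[K] TensorSpace K n r where
  toFun x := x
  invFun x := x
  map_add' _ _ := rfl
  map_smul' _ _ := rfl

/-- The pure tensor `v_1 ⊗ ⋯ ⊗ v_r`, as a multilinear map of `v_1, …, v_r`. -/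
def pureTensor : MultilinearMap K (fun _ : Fin r => (Fin n → K)) (TensorSpace K n r) :=
  (tensorSpaceEquiv K n r).toLinearMap.compMultilinearMap (PiTensorProduct.tprod K)

/-- The place permutation of `V^{⊗ r}` given by `σ`, for which
`v_1 ⊗ ⋯ ⊗ v_r ↦ v_{σ⁻¹ 1} ⊗ ⋯ ⊗ v_{σ⁻¹ r}`. -/
def placePerm (σ : Equiv.Perm (Fin r)) : Module.End K (TensorSpace K n r) :=
  (tensorSpaceEquiv K n r).conj
    (PiTensorProduct.reindex K (fun _ : Fin r => (Fin n → K)) σ).toLinearMap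

/-- The endomorphisms of `V^{⊗ r}` that commute with all place permutations. -/
def schurSubalgebra : Subalgebra K (Module.End K (TensorSpace K n r)) :=
  Subalgebra.centralizer K (Set.range (placePerm K n r))

/-- The Schur algebra `S = S_K(n,r) = End_{K 𝔖_r}(V^{⊗ r})`. -/
def SchurAlgebra : Type _ := schurSubalgebra K n r

instance : Ring (SchurAlgebra K n r) := inferInstanceAs (Ring (schurSubalgebra K n r))

instance : Algebra K (SchurAlgebra K n r) := inferInstanceAs (Algebra K (schurSubalgebra K n r))

/-- `S` acts on `V^{⊗ r}` by evaluation. -/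
instance : Module (SchurAlgebra K n r) (TensorSpace K n r) :=
  inferInstanceAs (Module (schurSubalgebra K n r) (TensorSpace K n r))

instance : IsScalarTower K (SchurAlgebra K n r) (TensorSpace K n r) :=
  inferInstanceAs (IsScalarTower K (schurSubalgebra K n r) (TensorSpace K n r))

/-- The elements of the Schur algebra as endomorphisms of `V^{⊗ r}`. -/
def schurToEnd : SchurAlgebra K n r →ₐ[K] Module.End K (TensorSpace K n r) :=
  (schurSubalgebra K n r).val

variable {K n r}

@[simp] lemma placePerm_pureTensor (σ : Equiv.Perm (Fin r)) (v : Fin r → (Fin n → K)) :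
    placePerm K n r σ (pureTensor K n r v) =
      pureTensor K n r fun i => v (σ.symm i) := by
  simp [placePerm, pureTensor]

lemma schur_smul_def (s : SchurAlgebra K n r) (x : TensorSpace K n r) :
    s • x = schurToEnd K n r s x := rfl

lemma placePerm_smul (s : SchurAlgebra K n r) (σ : Equiv.Perm (Fin r))
    (x : TensorSpace K n r) : placePerm K n r σ (s • x) = s • placePerm K n r σ x := by
  have hs : schurToEnd K n r s ∈ schurSubalgebra K n r := s.2
  have h := (Subalgebra.mem_centralizer_iff K).1 hs _ ⟨σ, rfl⟩
  exact LinearMap.congr_fun h x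

/-- For a filling `row` of the `r` tensor places by row indices, the tensors in `V^{⊗ r}` that are
symmetric in the places of each row. When row `i` has `a_i` places this is
`D(a) = D_{a_1} V ⊗ ⋯ ⊗ D_{a_n} V`, with the divided power `D_a V` (the dual of the degree `a` part
of the symmetric algebra of `V*`) realised as the symmetric tensors `(V^{⊗ a})^{𝔖_a}`: the
element `e_1^{(a_1)} ⋯ e_n^{(a_n)}` is the sum of all distinct rearrangements of
`e_1^{⊗ a_1} ⊗ ⋯ ⊗ e_n^{⊗ a_n}`. -/
def dividedPowers {ι : Type*} (row : Fin r → ι) :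
    Submodule (SchurAlgebra K n r) (TensorSpace K n r) where
  carrier := {x | ∀ σ : Equiv.Perm (Fin r), (∀ k, row (σ k) = row k) → placePerm K n r σ x = x}
  add_mem' := fun hx hy σ hσ => by rw [map_add, hx σ hσ, hy σ hσ]
  zero_mem' := fun σ _ => map_zero _
  smul_mem' := fun s x hx σ hσ => by rw [placePerm_smul, hx σ hσ]

/-- A tensor that is symmetric in two places `k ≠ l` lies in the `K`-span of the pure tensors with
equal vectors in these places. -/
lemma mem_span_of_swap_eq {k l : Fin r} (hkl : k ≠ l) (x : TensorSpace K n r)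
    (hx : placePerm K n r (Equiv.swap k l) x = x) :
    x ∈ Submodule.span K {t : TensorSpace K n r |
      ∃ v : Fin r → (Fin n → K), v k = v l ∧ pureTensor K n r v = t} := by
  classical
  set N := Submodule.span K {t : TensorSpace K n r |
      ∃ v : Fin r → (Fin n → K), v k = v l ∧ pureTensor K n r v = t} with hN
  let e : (Fin r → Fin n) → TensorSpace K n r := fun f =>
    pureTensor K n r fun i => (Pi.single (f i) (1 : K) : Fin n → K)
  let b : Module.Basis (Fin r → Fin n) K (TensorSpace K n r) :=
    (Basis.piTensorProduct fun _ => Pi.basisFun K (Fin n)).map (tensorSpaceEquiv K n r)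
  have hb : ∀ f, b f = e f := fun f => by
    simp [b, e, pureTensor, Basis.piTensorProduct_apply]
  let τ : (Fin r → Fin n) ≃ (Fin r → Fin n) := (Equiv.swap k l).arrowCongr (Equiv.refl _)
  have hτ : ∀ f i, τ f i = f (Equiv.swap k l i) := fun f i => rfl
  have hττ : ∀ f, τ (τ f) = f := fun f => by ext i; simp [hτ]
  have hbτ : ∀ f, placePerm K n r (Equiv.swap k l) (b f) = b (τ f) := fun f => by
    rw [hb, hb]; simp [e, hτ]
  have hc : ∀ f, b.repr x (τ f) = b.repr x f := by
    intro f
    have h1 : b.coord (τ f) ∘ₗ placePerm K n r (Equiv.swap k l) = b.coord f := by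
      refine b.ext fun g => ?_
      simp only [LinearMap.comp_apply, hbτ, Module.Basis.coord_apply, Module.Basis.repr_self]
      simp [Finsupp.single_apply]
    have h2 := LinearMap.congr_fun h1 x
    simpa [hx] using h2
  have hdiag : ∀ f : Fin r → Fin n, f k = f l → b f ∈ N := fun f hf => by
    rw [hb]; exact Submodule.subset_span ⟨_, by simp [hf], rfl⟩
  have hpair : ∀ f : Fin r → Fin n, b f + b (τ f) ∈ N := by
    intro f
    let w : Fin r → Fin n → K := fun i => Pi.single (f i) 1
    let T : (Fin n → K) → (Fin n → K) → TensorSpace K n r := fun p q =>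
      pureTensor K n r (Function.update (Function.update w k p) l q)
    have hT : ∀ p, T p p ∈ N := fun p =>
      Submodule.subset_span ⟨_, by simp [hkl], rfl⟩
    have hadd : T (w k + w l) (w k + w l)
        = T (w k) (w k) + T (w k) (w l) + (T (w l) (w k) + T (w l) (w l)) := by
      simp only [T]
      rw [MultilinearMap.map_update_add]
      simp only [Function.update_comm hkl]
      rw [MultilinearMap.map_update_add, MultilinearMap.map_update_add]
      abel
    have h1 : T (w k) (w l) = b f := by
      rw [hb]; simp only [T, e, Function.update_eq_self]; rfl
    have h2 : T (w l) (w k) = b (τ f) := by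
      rw [hb]; simp only [T, e]
      congr 1
      funext i
      rw [hτ]
      by_cases hil : i = l
      · subst hil; simp [w]
      · by_cases hik : i = k
        · subst hik; simp [w, hkl]
        · simp [w, hil, hik, Equiv.swap_apply_of_ne_of_ne hik hil]
    have h3 : b f + b (τ f) = T (w k + w l) (w k + w l) - T (w k) (w k) - T (w l) (w l) := by
      rw [hadd, h1, h2]; abel
    rw [h3]
    exact N.sub_mem (N.sub_mem (hT _) (hT _)) (hT _)
  rw [← b.sum_repr x]
  have hsplit : ∑ f, b.repr x f • b f =
      ∑ f, (if f k = f l then b.repr x f • b f else 0) +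
      ∑ f, (if f k < f l then b.repr x f • (b f + b (τ f)) else 0) := by
    have h4 : ∑ f, (if f k < f l then b.repr x f • b (τ f) else 0) =
        ∑ f, (if f l < f k then b.repr x f • b f else 0) := by
      refine Fintype.sum_equiv τ _ _ fun f => ?_
      simp [hτ, hc]
    simp only [smul_add]
    have h5 : ∀ f : Fin r → Fin n,
        (if f k < f l then b.repr x f • b f + b.repr x f • b (τ f) else 0) =
        (if f k < f l then b.repr x f • b f else 0) +
        (if f k < f l then b.repr x f • b (τ f) else 0) := fun f => by split_ifs <;> simp
    simp only [h5, Finset.sum_add_distrib, h4]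
    simp only [← Finset.sum_add_distrib]
    refine Finset.sum_congr rfl fun f _ => ?_
    rcases lt_trichotomy (f k) (f l) with h | h | h
    · simp [h, h.ne, h.not_gt]
    · simp [h]
    · simp [h, h.ne', h.not_gt]
  rw [hsplit]
  refine N.add_mem (N.sum_mem fun f _ => ?_) (N.sum_mem fun f _ => ?_)
  · split_ifs with h
    · exact N.smul_mem _ (hdiag f h)
    · exact N.zero_mem
  · split_ifs with h
    · exact N.smul_mem _ (hpair f)
    · exact N.zero_mem

/-- For a filling `col` of the tensor places by column indices, the `K`-span of the pure tensors
`v_1 ⊗ ⋯ ⊗ v_r` with `v_k = v_l` for two different places `k, l` of the same column. It is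
stable under the Schur algebra. -/
def alternatingRelations {ι : Type*} (col : Fin r → ι) :
    Submodule (SchurAlgebra K n r) (TensorSpace K n r) where
  __ := (Submodule.span K {t : TensorSpace K n r | ∃ (v : Fin r → (Fin n → K)) (k l : Fin r),
      k ≠ l ∧ col k = col l ∧ v k = v l ∧ pureTensor K n r v = t}).toAddSubmonoid
  smul_mem' := by
    intro s x hx
    change s • x ∈ Submodule.span K _
    change x ∈ Submodule.span K _ at hx
    induction hx using Submodule.span_induction with
    | mem t ht =>
      obtain ⟨v, k, l, hkl, hcol, hv, rfl⟩ := ht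
      have hinv : placePerm K n r (Equiv.swap k l) (s • pureTensor K n r v)
          = s • pureTensor K n r v := by
        rw [placePerm_smul, placePerm_pureTensor]
        congr 2
        funext i
        by_cases hik : i = k
        · subst hik; simp [hv]
        · by_cases hil : i = l
          · subst hil; simp [hv]
          · simp [Equiv.swap_apply_of_ne_of_ne hik hil]
      refine Submodule.span_mono ?_ (mem_span_of_swap_eq hkl _ hinv)
      rintro t ⟨w, hw, rfl⟩
      exact ⟨w, k, l, hkl, hcol, hw, rfl⟩
    | zero => rw [smul_zero]; exact Submodule.zero_mem _
    | add x y _ _ hx hy => rw [smul_add]; exact Submodule.add_mem _ hx hy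
    | smul a x _ hx => rw [smul_comm]; exact Submodule.smul_mem _ a hx

variable (K) in
/-- When column `j` has `c_j` places this is `Λ(c) = Λ^{c_1} V ⊗ Λ^{c_2} V ⊗ ⋯`, as the quotient
of `V^{⊗ r}` by the alternating relations within each column. -/
abbrev exteriorPowers {ι : Type*} (n : ℕ) (col : Fin r → ι) : Type _ :=
  TensorSpace K n r ⧸ alternatingRelations (K := K) (n := n) col

end TensorSpace

namespace PartitionOf

variable {n r : ℕ} (lam : PartitionOf n r)

/-- The tensor places `1, …, r` as the boxes (row, position in the row) of the diagram of `λ`, in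
row reading order. -/
def box : Fin r ≃ (Σ i : Fin n, Fin (lam.part i)) :=
  (finCongr lam.sum_eq.symm).trans finSigmaFinEquiv.symm

/-- The row of the diagram that contains the place `k`. -/
def row (k : Fin r) : ℕ := (lam.box k).1

/-- The column of the diagram that contains the place `k`. -/
def col (k : Fin r) : ℕ := (lam.box k).2

variable (K : Type*) [Field K]

/-- The map `d'_λ : D(λ) → Λ(λᵗ)`: diagonalise `D(λ)` into `V^{⊗ r}` along the rows of the diagram,
then multiply along its columns. -/
def dMap : dividedPowers (K := K) (n := n) lam.row →ₗ[SchurAlgebra K n r]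
    exteriorPowers K n lam.col :=
  (alternatingRelations lam.col).mkQ ∘ₗ (dividedPowers lam.row).subtype

/-- The Weyl module `Δ(λ)`: the image of `d'_λ`. -/
def weyl : Submodule (SchurAlgebra K n r) (exteriorPowers K n lam.col) :=
  LinearMap.range (lam.dMap K)

end PartitionOf

end

/-! A homomorphism out of Δ(λ) is a homomorphism out of D(λ) that kills the kernel of d'_λ. By
`mem_relations` this kernel is spanned by images of tensors in which row i has gained, and row j = i
+ 1 has lost, some t ≥ 1 places. The proof is a Garnir straightening. In a kernel element take a
word of least row weight, sorted along the rows. If one of its columns fails to increase, it is the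
leading word of a relation (`exists_straightening`) and can be subtracted. Otherwise the
antisymmetrised coefficient `columnForm` sees it alone, although that form vanishes on alternating
relations.

To treat all D(α) at once, an element is spread to an equivariant family T indexed by labellings of
the places: T h is symmetric in places with equal labels, and a transvection acts as the exponential
of a root vector. A map D(λ) → D(μ) is then T ↦ ∑ T g, over a set of labellings g of content λ that
is stable under the row permutations of μ.

Two such sets are used (rows and labels start at 0). In both, the label 0 occurs only in the first
row of μ; in the second, moreover, that row has only labels 0 and 1. A relation lowering i to j is
sent to ∑ N(h) T h, where N(h) counts the admissible lowerings of h. If i ≥ 1, each term vanishes: T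
h = 0 when nothing is lowered, and otherwise N(h) is 0 or a binomial coefficient divisible by p, by
(2), or by (4) for i = 1 and the second set.

If i = 0, the relations of Δ(μ) are needed (`sum_lowerCount_mem`). Vandermonde's identity writes
N(h) as a sum over place sets R containing the first row of μ, with coefficients symmetric in R. A
larger R contains two places of one column, so its part is zero in the exterior powers; for R equal
to the first row the coefficients are divisible by p, by (1) or (3).

The two homomorphisms are independent because one word is admissible for the first set only and
another for both (`columnForm_spreadMap`). -/

/-! ### Permutations of fillings and the rearrangement inequality -/

section Combinatorics

/-- Two functions on a finite type with equally large fibres differ by a permutation. -/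
lemma exists_perm_comp_of_card_fiber {α β : Type*} [Fintype α] [DecidableEq β] (f g : α → β)
    (h : ∀ c, (Finset.univ.filter fun k => f k = c).card =
      (Finset.univ.filter fun k => g k = c).card) :
    ∃ σ : Equiv.Perm α, f = g ∘ σ := by
  classical
  have e : ∀ c, Nonempty ({k // f k = c} ≃ {k // g k = c}) := fun c => by
    rw [← Fintype.card_eq, Fintype.card_subtype, Fintype.card_subtype]
    exact h c
  refine ⟨(Equiv.sigmaFiberEquiv f).symm.trans ((Equiv.sigmaCongrRight fun c => (e c).some).trans
    (Equiv.sigmaFiberEquiv g)), ?_⟩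
  funext k
  have := ((e (f k)).some ⟨k, rfl⟩).2
  exact this.symm

lemma card_fiber_comp_perm {α β : Type*} [Fintype α] [DecidableEq β] (g : α → β)
    (σ : Equiv.Perm α) (p : β → Prop) [DecidablePred p] :
    (Finset.univ.filter fun k => p (g (σ k))).card = (Finset.univ.filter fun k => p (g k)).card :=
  Finset.card_bij' (fun k _ => σ k) (fun k _ => σ.symm k) (by simp) (by simp) (by simp) (by simp)

/-- A permutation of a finite type that strictly preserves the order pulled back along an injective
function is trivial. -/
lemma perm_eq_one_of_strictMono {α : Type*} [Fintype α] (f : α → ℕ) (hf : Function.Injective f)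
    (τ : Equiv.Perm α) (hτ : ∀ k l, f k < f l → f (τ k) < f (τ l)) : τ = 1 := by
  have hle : ∀ N k, f k = N → f k ≤ f (τ k) := by
    intro N
    induction N using Nat.strong_induction_on with
    | _ N ih =>
      intro k hk
      by_contra! hlt
      exact absurd (hτ _ _ hlt) (not_lt.2 (ih _ (hk ▸ hlt) _ rfl))
  have hsum : ∑ k, f k = ∑ k, f (τ k) := (Equiv.sum_comp τ f).symm
  have := (Finset.sum_eq_sum_iff_of_le fun k _ => hle _ k rfl).1 hsum
  ext k
  exact (hf (this k (Finset.mem_univ k))).symm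

/-- For a filling `u` whose columns increase strictly, a column preserving permutation that does not
decrease `∑ row · u` is trivial. -/
lemma perm_eq_one_of_sum_le {α : Type*} [Fintype α] {n : ℕ} (row col u : α → ℕ)
    (hrow : ∀ k, row k < n) (hu : ∀ k, u k < n)
    (hinj : ∀ k l, row k = row l → col k = col l → k = l)
    (hstrict : ∀ k l, col k = col l → row k < row l → u k < u l)
    (τ : Equiv.Perm α) (hτ : ∀ k, col (τ k) = col k)
    (hle : ∑ k, row k * u k ≤ ∑ k, row k * u (τ k)) : τ = 1 := by
  -- Lexicographic codes of (column, row) and (column, entry). Strict columns make both orders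
  -- coincide, and the column terms are unaffected by τ, so the rearrangement inequality applies to
  -- f and g.
  set f : α → ℕ := fun k => row k + n * col k with hf
  set g : α → ℕ := fun k => u k + n * col k with hg
  have key : ∀ (a b : ℕ) {c d : ℕ}, c < n → d < n →
      (c + n * a < d + n * b ↔ a < b ∨ a = b ∧ c < d) := by
    intro a b c d hc hd
    constructor
    · intro h
      rcases lt_trichotomy a b with h1 | h1 | h1
      · exact Or.inl h1
      · subst h1; right; exact ⟨rfl, by omega⟩
      · exfalso; nlinarith [Nat.mul_le_mul_left n (Nat.succ_le_of_lt h1), Nat.mul_succ n b]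
    · rintro (h | ⟨rfl, h⟩)
      · nlinarith [Nat.mul_le_mul_left n (Nat.succ_le_of_lt h), Nat.mul_succ n a]
      · omega
  have hfg : ∀ k l, f k < f l ↔ g k < g l := by
    intro k l
    rw [hf, hg]
    simp only
    rw [key _ _ (hrow k) (hrow l), key _ _ (hu k) (hu l)]
    refine or_congr Iff.rfl (and_congr_right fun hc => ⟨hstrict k l hc, fun h => ?_⟩)
    rcases lt_trichotomy (row k) (row l) with h1 | h1 | h1
    · exact h1
    · rw [hinj k l h1 hc] at h; exact absurd h (lt_irrefl _)
    · exact absurd h (hstrict l k hc.symm h1).not_gt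
  have hfinj : Function.Injective f := by
    intro k l h
    have h1 : ¬ f k < f l := by omega
    have h2 : ¬ f l < f k := by omega
    rw [hf] at h1 h2
    simp only at h1 h2
    rw [key _ _ (hrow _) (hrow _)] at h1 h2
    push Not at h1 h2
    have hc : col k = col l := by omega
    exact hinj k l (le_antisymm (h2.2 hc.symm) (h1.2 hc)) hc
  have hmono : Monovary f g := fun k l h => ((hfg k l).2 h).le
  have hexp : ∀ σ : Equiv.Perm α, (∀ k, col (σ k) = col k) → ∑ k, f k * g (σ k) =
      ∑ k, row k * u (σ k) + (∑ k, n * col k * u k + ∑ k, f k * (n * col k)) := by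
    intro σ hσ
    have h2 : ∑ k, n * col k * u k = ∑ k, n * col k * u (σ k) := by
      rw [← Equiv.sum_comp σ]; simp [hσ]
    rw [h2, ← Finset.sum_add_distrib, ← Finset.sum_add_distrib]
    refine Finset.sum_congr rfl fun k _ => ?_
    simp only [hf, hg, hσ]; ring
  have heq : ∑ k, f k * g (τ k) = ∑ k, f k * g k := by
    refine le_antisymm hmono.sum_mul_comp_perm_le_sum_mul ?_
    have h1 := hexp τ hτ
    have h2 := hexp 1 (by simp)
    simp only [Equiv.Perm.coe_one, id_eq] at h2
    omega
  -- In the equality case f and g ∘ τ still vary together, so τ preserves the order given by f.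
  have hm := hmono.sum_mul_comp_perm_eq_sum_mul_iff.1 heq
  refine perm_eq_one_of_strictMono f hfinj τ fun k l hkl => ?_
  by_contra! hlt
  rcases hlt.lt_or_eq with h | h
  · exact absurd hkl (not_lt.2 (hm ((hfg _ _).1 h)))
  · have := τ.injective (hfinj h)
    subst this; exact lt_irrefl _ hkl

lemma apply_swap_of_eq {α β : Type*} [DecidableEq α] {f : α → β} {k l : α} (h : f k = f l) (j : α) :
    f (Equiv.swap k l j) = f j := by
  rw [Equiv.swap_apply_def]
  split_ifs with h1 h2
  · rw [h1, h]
  · rw [h2, h]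
  · rfl

end Combinatorics

noncomputable section

/-! ### The word basis and antisymmetrised coefficients -/

section TensorBasis

variable {K : Type*} [Field K] {n r : ℕ}

variable (K n r) in
/-- The basis of `V^{⊗ r}` by the words of length `r` in the standard basis of `V`. -/
def wordBasis : Module.Basis (Fin r → Fin n) K (TensorSpace K n r) :=
  (Basis.piTensorProduct fun _ => Pi.basisFun K (Fin n)).map (tensorSpaceEquiv K n r)

lemma wordBasis_apply (w : Fin r → Fin n) :
    wordBasis K n r w = pureTensor K n r fun i => (Pi.single (w i) (1 : K) : Fin n → K) := by
  simp [wordBasis, pureTensor, Basis.piTensorProduct_apply]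

lemma wordBasis_repr_pureTensor (v : Fin r → Fin n → K) (w : Fin r → Fin n) :
    (wordBasis K n r).repr (pureTensor K n r v) w = ∏ i, v i (w i) := by
  simp [wordBasis, pureTensor, Basis.piTensorProduct_repr_tprod_apply]

lemma placePerm_wordBasis (σ : Equiv.Perm (Fin r)) (w : Fin r → Fin n) :
    placePerm K n r σ (wordBasis K n r w) = wordBasis K n r (w ∘ σ.symm) := by
  simp [wordBasis_apply]

lemma repr_placePerm (σ : Equiv.Perm (Fin r)) (x : TensorSpace K n r) (w : Fin r → Fin n) :
    (wordBasis K n r).repr (placePerm K n r σ x) w = (wordBasis K n r).repr x (w ∘ σ) := by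
  classical
  have : (wordBasis K n r).coord w ∘ₗ placePerm K n r σ = (wordBasis K n r).coord (w ∘ σ) := by
    refine (wordBasis K n r).ext fun f => ?_
    simp only [LinearMap.comp_apply, placePerm_wordBasis, Module.Basis.coord_apply,
      Module.Basis.repr_self, Finsupp.single_apply]
    refine if_congr ⟨fun h => ?_, fun h => ?_⟩ rfl rfl
    · rw [← h]; funext i; simp
    · rw [h]; funext i; simp
  exact LinearMap.congr_fun this x

lemma placePerm_mul (σ τ : Equiv.Perm (Fin r)) (x : TensorSpace K n r) :
    placePerm K n r (σ * τ) x = placePerm K n r σ (placePerm K n r τ x) := by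
  refine (wordBasis K n r).repr.injective (Finsupp.ext fun w => ?_)
  simp only [repr_placePerm]
  rfl

/-- Valid in every characteristic, 2 included, since `mem_span_of_swap_eq` produces pure tensors
with a repeated vector. Every nontrivial vanishing in the exterior powers below comes from this
criterion. -/
lemma mem_alternatingRelations_of_swap {ι : Type*} {col : Fin r → ι} {k l : Fin r} (hkl : k ≠ l)
    (hcol : col k = col l) {x : TensorSpace K n r}
    (hx : placePerm K n r (Equiv.swap k l) x = x) :
    x ∈ alternatingRelations (K := K) (n := n) col := by
  change x ∈ Submodule.span K _
  refine Submodule.span_mono ?_ (mem_span_of_swap_eq hkl x hx)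
  rintro t ⟨v, hv, rfl⟩
  exact ⟨v, k, l, hkl, hcol, hv, rfl⟩

lemma smul_mem_alternatingRelations {ι : Type*} {col : Fin r → ι} {x : TensorSpace K n r}
    (a : K) (hx : x ∈ alternatingRelations (K := K) (n := n) col) :
    a • x ∈ alternatingRelations (K := K) (n := n) col := by
  change x ∈ Submodule.span K _ at hx
  change a • x ∈ Submodule.span K _
  exact Submodule.smul_mem _ a hx

/-- The coefficient of the word `u`, antisymmetrised along the columns. -/
def columnForm {ι : Type*} (col : Fin r → ι) (u : Fin r → Fin n) : TensorSpace K n r →ₗ[K] K :=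
  open Classical in
  ∑ τ : Equiv.Perm (Fin r), if ∀ k, col (τ k) = col k then
    ((Equiv.Perm.sign τ : ℤ) : K) • (wordBasis K n r).coord (u ∘ τ) else 0

open Classical in
lemma columnForm_apply {ι : Type*} (col : Fin r → ι) (u : Fin r → Fin n) (x : TensorSpace K n r) :
    columnForm col u x = ∑ τ : Equiv.Perm (Fin r), if ∀ k, col (τ k) = col k then
      ((Equiv.Perm.sign τ : ℤ) : K) * (wordBasis K n r).repr x (u ∘ τ) else 0 := by
  rw [columnForm, LinearMap.sum_apply]
  refine Finset.sum_congr rfl fun τ _ => ?_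
  split_ifs <;> simp

/-- The terms of τ and τ * swap k l cancel. This makes `columnForm` a test for being nonzero in the
exterior powers, used for straightening and for linear independence. -/
lemma columnForm_eq_zero {ι : Type*} {col : Fin r → ι} (u : Fin r → Fin n) {x : TensorSpace K n r}
    (hx : x ∈ alternatingRelations (K := K) (n := n) col) : columnForm col u x = 0 := by
  classical
  change x ∈ Submodule.span K _ at hx
  rw [← LinearMap.mem_ker]
  revert x
  change Submodule.span K _ ≤ _
  rw [Submodule.span_le]
  rintro _ ⟨v, k, l, hkl, hcol, hv, rfl⟩
  rw [SetLike.mem_coe, LinearMap.mem_ker, columnForm_apply]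
  refine Finset.sum_involution (fun τ _ => τ * Equiv.swap k l) ?_ ?_ (by simp) ?_
  · intro τ _
    have hc : (∀ j, col ((τ * Equiv.swap k l) j) = col j) ↔ ∀ j, col (τ j) = col j := by
      have hs : ∀ j, col (Equiv.swap k l j) = col j := apply_swap_of_eq hcol
      constructor
      · intro h j
        have := h (Equiv.swap k l j)
        rw [hs] at this
        simpa using this
      · intro h j
        rw [Equiv.Perm.mul_apply, h, hs]
    have hp : ∏ i, v i (u (τ (Equiv.swap k l i))) = ∏ i, v i (u (τ i)) := by
      rw [← Equiv.prod_comp (Equiv.swap k l)]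
      refine Finset.prod_congr rfl fun i _ => ?_
      rw [Equiv.swap_apply_self, apply_swap_of_eq hv]
    rw [if_congr hc rfl rfl]
    split_ifs
    · simp [wordBasis_repr_pureTensor, Equiv.Perm.sign_mul, Equiv.Perm.sign_swap hkl, hp]
    · simp
  · intro τ _ _ h
    have : Equiv.swap k l = 1 := mul_left_cancel (h.trans (mul_one τ).symm)
    exact hkl (Equiv.swap_eq_one_iff.1 this)
  · intro τ _
    simp [mul_assoc]

end TensorBasis

/-! ### Equivariant families of tensors and the action of matrices on labels -/

section Family

variable {K : Type*} [Field K] {n r : ℕ} {ι L : Type*}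

/-- A family of tensors indexed by labellings of the places, equivariant for the permutations of
the places. The value at `h` is symmetric in places with the same label. -/
def IsFamily (T : (Fin r → ι) → TensorSpace K n r) : Prop :=
  ∀ (σ : Equiv.Perm (Fin r)) (h : Fin r → ι), placePerm K n r σ (T h) = T (h ∘ σ.symm)

lemma IsFamily.swap {T : (Fin r → ι) → TensorSpace K n r} (hT : IsFamily T) {h : Fin r → ι}
    {k l : Fin r} (hkl : h k = h l) : placePerm K n r (Equiv.swap k l) (T h) = T h := by
  rw [hT]
  congr 1
  funext j
  rw [Function.comp_apply, Equiv.symm_swap, apply_swap_of_eq hkl]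

lemma IsFamily.eq_zero {T : (Fin r → ι) → TensorSpace K n r} (hT : IsFamily T) {h : Fin r → ι}
    (h0 : T h = 0) (σ : Equiv.Perm (Fin r)) : T (h ∘ σ) = 0 := by
  have := hT σ.symm h
  rw [h0, map_zero, Equiv.symm_symm] at this
  exact this.symm

/-- The functorial action of matrices on families. -/
def famAct [Fintype L] (a : Matrix L ι K) (T : (Fin r → L) → TensorSpace K n r)
    (g : Fin r → ι) : TensorSpace K n r :=
  ∑ h : Fin r → L, (∏ k, a (h k) (g k)) • T h

lemma IsFamily.famAct [Fintype L] {T : (Fin r → L) → TensorSpace K n r} (hT : IsFamily T)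
    (a : Matrix L ι K) : IsFamily (famAct a T) := by
  intro σ g
  simp only [_root_.famAct, map_sum, map_smul, hT σ]
  refine Fintype.sum_equiv (Equiv.arrowCongr σ (Equiv.refl L)) _ _ fun h => ?_
  congr 1
  rw [← Equiv.prod_comp σ.symm]
  rfl

lemma famAct_famAct {M : Type*} [Fintype L] [Fintype ι] [DecidableEq L] [DecidableEq ι]
    (a : Matrix L ι K) (b : Matrix ι M K)
    (T : (Fin r → L) → TensorSpace K n r) (g : Fin r → M) :
    famAct b (famAct a T) g = famAct (a * b) T g := by
  simp only [famAct, Finset.smul_sum, smul_smul]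
  rw [Finset.sum_comm]
  refine Finset.sum_congr rfl fun h _ => ?_
  rw [← Finset.sum_smul]
  congr 1
  simp only [Matrix.mul_apply]
  rw [Finset.prod_univ_sum, Fintype.piFinset_univ]
  refine Finset.sum_congr rfl fun f _ => ?_
  rw [← Finset.prod_mul_distrib]
  exact Finset.prod_congr rfl fun k _ => mul_comm _ _

open Matrix in
lemma prod_transvection [DecidableEq ι] [Fintype ι] {i j : ι} (hij : i ≠ j) (h g : Fin r → ι)
    [Decidable (∀ k, g k = h k ∨ h k = i ∧ g k = j)] :
    (∏ k, transvection i j (1 : K) (h k) (g k)) =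
      if ∀ k, g k = h k ∨ h k = i ∧ g k = j then 1 else 0 := by
  have h1 : ∀ k, transvection i j (1 : K) (h k) (g k) =
      if g k = h k ∨ h k = i ∧ g k = j then 1 else 0 := by
    intro k
    rw [transvection, Matrix.add_apply, Matrix.one_apply, Matrix.single_apply]
    by_cases h2 : h k = g k
    · simp only [h2, if_true, true_or, add_eq_left, ite_eq_right_iff, one_ne_zero, imp_false,
        not_and]
      intro h4 h5; exact absurd (h4.trans h5.symm) hij
    · by_cases h3 : i = h k ∧ j = g k
      · simp [h2, h3, Ne.symm h2]
      · have : ¬ (h k = i ∧ g k = j) := fun h4 => h3 ⟨h4.1.symm, h4.2.symm⟩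
        simp [h2, h3, this, Ne.symm h2]
  simp only [h1]
  split_ifs with h2
  · exact Finset.prod_eq_one fun k _ => if_pos (h2 k)
  · push Not at h2
    obtain ⟨k, hk1, hk2⟩ := h2
    refine Finset.prod_eq_zero (Finset.mem_univ k) (if_neg ?_)
    rintro (h | h)
    · exact hk1 h
    · exact hk2 h.1 h.2

-- Every set of moved places has coefficient 1: all divided powers of the root vector occur
-- together, without denominators.
open Classical in
lemma famAct_transvection [Fintype ι] [DecidableEq ι] {i j : ι} (hij : i ≠ j)
    (T : (Fin r → ι) → TensorSpace K n r) (g : Fin r → ι) :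
    famAct (Matrix.transvection i j (1 : K)) T g =
      ∑ h : Fin r → ι, if ∀ k, g k = h k ∨ h k = i ∧ g k = j then T h else 0 := by
  refine Finset.sum_congr rfl fun h _ => ?_
  rw [prod_transvection hij]
  split_ifs <;> simp

end Family

end

/-! ### Straightening and the kernel of d'_λ -/

noncomputable section

namespace PartitionOf

variable {n r : ℕ} (lam : PartitionOf n r)

/-- The row of the place `k`, as an element of `Fin n`. -/
def rowFin (k : Fin r) : Fin n := (lam.box k).1

lemma row_eq (k : Fin r) : lam.row k = lam.rowFin k := rfl

lemma box_injective {k l : Fin r} (h1 : lam.rowFin k = lam.rowFin l) (h2 : lam.col k = lam.col l) :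
    k = l := by
  apply lam.box.injective
  refine Sigma.ext h1 ?_
  unfold rowFin at h1
  unfold col at h2
  generalize lam.box k = a at *
  generalize lam.box l = b at *
  obtain ⟨a, a'⟩ := a
  obtain ⟨b, b'⟩ := b
  subst h1
  exact heq_of_eq (Fin.ext h2)

lemma exists_box (i : Fin n) {c : ℕ} (hc : c < lam.part i) :
    ∃ k, lam.rowFin k = i ∧ lam.col k = c :=
  ⟨lam.box.symm ⟨i, c, hc⟩, by rw [rowFin, Equiv.apply_symm_apply],
    by rw [col, Equiv.apply_symm_apply]⟩

lemma col_lt (k : Fin r) : lam.col k < lam.part (lam.rowFin k) := (lam.box k).2.2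

lemma card_rowFin (i : Fin n) : (Finset.univ.filter fun k => lam.rowFin k = i).card = lam.part i := by
  rw [← Finset.card_range (lam.part i)]
  refine Finset.card_nbij lam.col ?_ ?_ ?_
  · intro k hk
    simp only [Finset.coe_filter, Finset.mem_univ, true_and, Set.mem_ofPred_eq] at hk
    simpa [hk] using lam.col_lt k
  · intro k hk l hl h
    simp only [Finset.coe_filter, Finset.mem_univ, true_and, Set.mem_ofPred_eq] at hk hl
    exact lam.box_injective (hk.trans hl.symm) h
  · intro c hc
    obtain ⟨k, hk, hk'⟩ := lam.exists_box i (Finset.mem_range.1 (Finset.mem_coe.1 hc))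
    exact ⟨k, by simp [hk], hk'⟩

variable (K : Type*) [Field K]

/-- The relations between adjacent rows: the values at the filling by rows of the images of
families without component of weight `λ` under the exponential of a simple root vector. -/
def relations : Submodule K (TensorSpace K n r) :=
  Submodule.span K {y | ∃ (i j : Fin n) (T : (Fin r → Fin n) → TensorSpace K n r),
    (j : ℕ) = i + 1 ∧ IsFamily T ∧ T lam.rowFin = 0 ∧
      famAct (Matrix.transvection i j (1 : K)) T lam.rowFin = y}

variable {K}

/-- If h ≠ `lam.rowFin` contributes, some place l of row j is labelled i. The box above l in row i
is labelled i too, so T h is symmetric in two places of one column. -/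
lemma mem_alternatingRelations_of_mem_relations {x : TensorSpace K n r}
    (hx : x ∈ lam.relations K) : x ∈ alternatingRelations (K := K) (n := n) lam.col := by
  classical
  induction hx using Submodule.span_induction with
  | zero => exact Submodule.zero_mem _
  | add x y _ _ hx hy => exact Submodule.add_mem _ hx hy
  | smul a x _ hx => exact smul_mem_alternatingRelations a hx
  | mem y hy =>
    obtain ⟨i, j, T, hij, hT, hT0, rfl⟩ := hy
    have hne : i ≠ j := fun h => by rw [h] at hij; omega
    rw [famAct_transvection hne]
    refine Submodule.sum_mem _ fun h _ => ?_
    split_ifs with hh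
    swap
    · exact Submodule.zero_mem _
    by_cases hr : h = lam.rowFin
    · rw [hr, hT0]; exact Submodule.zero_mem _
    obtain ⟨l, hl⟩ := Function.ne_iff.1 hr
    have hl' := (hh l).resolve_left (Ne.symm hl)
    have hlt : lam.col l < lam.part i := by
      refine (lam.col_lt l).trans_le (lam.antitone ?_)
      rw [hl'.2, hij]; omega
    obtain ⟨k, hk, hkl⟩ := lam.exists_box i hlt
    have hki : h k = i := by
      rcases hh k with h1 | h1
      · rw [← h1, hk]
      · exact h1.1
    refine mem_alternatingRelations_of_swap (k := k) (l := l) ?_ hkl (hT.swap (hki.trans hl'.1.symm))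
    rintro rfl
    exact hne (hk.symm.trans hl'.2)

lemma mem_dividedPowers_of_mem_relations {x : TensorSpace K n r}
    (hx : x ∈ lam.relations K) : x ∈ dividedPowers (K := K) (n := n) lam.row := by
  classical
  induction hx using Submodule.span_induction with
  | zero => exact Submodule.zero_mem _
  | add x y _ _ hx hy => exact Submodule.add_mem _ hx hy
  | smul a x _ hx =>
    intro σ hσ
    rw [map_smul, hx σ hσ]
  | mem y hy =>
    obtain ⟨i, j, T, hij, hT, hT0, rfl⟩ := hy
    intro σ hσ
    rw [hT.famAct]
    congr 1
    funext k
    have := hσ (σ.symm k)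
    rw [Equiv.apply_symm_apply] at this
    exact Fin.ext this.symm

/-- The matrix that sends the label `none` to the two rows `i` and `j`. -/
def splitMatrix (K : Type*) [Field K] {n : ℕ} (i j : Fin n) : Matrix (Option (Fin n)) (Fin n) K :=
  fun x g => x.elim (if g = i ∨ g = j then 1 else 0) fun l => if g = l then 1 else 0

lemma splitMatrix_none (i j g : Fin n) :
    splitMatrix K i j none g = if g = i ∨ g = j then 1 else 0 := rfl

lemma splitMatrix_some (i j l g : Fin n) :
    splitMatrix K i j (some l) g = if g = l then 1 else 0 := rfl

/-- Too few labels `i` and `j` for row `j`: splitting the label `none` into the rows `i` and `j`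
gives a relation. -/
lemma famAct_splitMatrix_mem_relations {i j : Fin n} (hij : (j : ℕ) = i + 1)
    {T : (Fin r → Option (Fin n)) → TensorSpace K n r} (hT : IsFamily T)
    (hcard : ∀ h, T h ≠ 0 → (Finset.univ.filter fun k => h k = some i).card +
      (Finset.univ.filter fun k => h k = some j).card < lam.part j) :
    famAct (splitMatrix K i j) T lam.rowFin ∈ lam.relations K := by
  classical
  have hne : i ≠ j := fun h => by rw [h] at hij; omega
  -- Undoing the transvection first removes the entry of the matrix at (`none`, j). Row j can then
  -- be filled only from the labels i and j, which are too few, so the component at `lam.rowFin`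
  -- vanishes.
  refine Submodule.subset_span ⟨i, j,
    famAct (splitMatrix K i j * Matrix.transvection i j (-1 : K)) T, hij, hT.famAct _, ?_, ?_⟩
  · refine Finset.sum_eq_zero fun h _ => ?_
    by_cases hTh : T h = 0
    · rw [hTh, smul_zero]
    have hlt := hcard h hTh
    rw [← lam.card_rowFin j] at hlt
    obtain ⟨k, hk, hk'⟩ : ∃ k, lam.rowFin k = j ∧ ¬ (h k = some i ∨ h k = some j) := by
      by_contra! hcon
      refine absurd hlt (not_lt.2 ((Finset.card_le_card ?_).trans (Finset.card_union_le _ _)))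
      intro k hk
      simpa using hcon k (by simpa using hk)
    rw [Finset.prod_eq_zero (Finset.mem_univ k), zero_smul]
    rw [hk, Matrix.mul_transvection_apply_same]
    push Not at hk'
    cases hx : h k with
    | none => simp [splitMatrix_none]
    | some l =>
      rw [hx] at hk'
      have h1 : i ≠ l := fun h => hk'.1 (by rw [h])
      have h2 : j ≠ l := fun h => hk'.2 (by rw [h])
      simp [splitMatrix_some, h1, h2]
  · rw [famAct_famAct, Matrix.mul_assoc, Matrix.transvection_mul_transvection_same _ _ hne]
    simp

/-- The family of sums of all words `w` for which `(w, h)` is a rearrangement of `(w₀, h₀)`. -/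
def orbitFamily (K : Type*) [Field K] {n r : ℕ} {L : Type*} (w₀ : Fin r → Fin n) (h₀ : Fin r → L)
    (h : Fin r → L) : TensorSpace K n r :=
  open Classical in
  ∑ w : Fin r → Fin n, if ∃ σ : Equiv.Perm (Fin r), w = w₀ ∘ σ ∧ h = h₀ ∘ σ then
    wordBasis K n r w else 0

lemma isFamily_orbitFamily {L : Type*} (w₀ : Fin r → Fin n) (h₀ : Fin r → L) :
    IsFamily (orbitFamily K w₀ h₀) := by
  classical
  intro τ h
  simp only [orbitFamily, map_sum]
  refine Fintype.sum_equiv (Equiv.arrowCongr τ (Equiv.refl _)) _ _ fun w => ?_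
  rw [apply_ite (placePerm K n r τ), map_zero, placePerm_wordBasis]
  refine if_congr ⟨?_, ?_⟩ rfl rfl
  · rintro ⟨σ, rfl, rfl⟩
    exact ⟨σ * τ⁻¹, rfl, rfl⟩
  · rintro ⟨σ, h1, h2⟩
    refine ⟨σ * τ, funext fun k => ?_, funext fun k => ?_⟩
    · have := congrFun h1 (τ k)
      simpa [Equiv.arrowCongr] using this
    · have := congrFun h2 (τ k)
      simpa using this

open Classical in
lemma repr_orbitFamily {L : Type*} (w₀ w : Fin r → Fin n) (h₀ h : Fin r → L) :
    (wordBasis K n r).repr (orbitFamily K w₀ h₀ h) w =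
      if ∃ σ : Equiv.Perm (Fin r), w = w₀ ∘ σ ∧ h = h₀ ∘ σ then 1 else 0 := by
  rw [orbitFamily, map_sum, Finsupp.finsetSum_apply, Finset.sum_eq_single w]
  · split_ifs <;> simp
  · intro w' _ hw
    split_ifs <;> simp [hw]
  · simp

lemma exists_of_orbitFamily_ne_zero {L : Type*} {w₀ : Fin r → Fin n} {h₀ h : Fin r → L}
    (hne : orbitFamily K w₀ h₀ h ≠ 0) : ∃ σ : Equiv.Perm (Fin r), h = h₀ ∘ σ := by
  classical
  by_contra! hcon
  refine hne (Finset.sum_eq_zero fun w _ => if_neg ?_)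
  rintro ⟨σ, -, hσ⟩
  exact hcon σ hσ

/-- The statistic by which words are ordered in the straightening. -/
def rowWeight (w : Fin r → Fin n) : ℕ := ∑ k, lam.row k * w k

/-- Garnir argument with pivot κ = w₀ l₀. The entries ≥ κ of row i and ≤ κ of row j are pooled under
`none` and redistributed over both rows in all ways. Fewer than `lam.part j` entries of these rows
stay unpooled, so this is a relation. Any redistribution moves large entries down and small ones up,
so w₀ has the least row weight, and is the only such word up to row permutations. -/
lemma exists_straightening (w₀ : Fin r → Fin n)
    (hsort : ∀ k l, lam.rowFin k = lam.rowFin l → lam.col k ≤ lam.col l → w₀ k ≤ w₀ l)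
    {k₀ l₀ : Fin r} (hcol : lam.col k₀ = lam.col l₀)
    (hrow : (lam.rowFin l₀ : ℕ) = lam.rowFin k₀ + 1) (hw : w₀ l₀ ≤ w₀ k₀) :
    ∃ Y ∈ lam.relations K, (wordBasis K n r).repr Y w₀ = 1 ∧
      ∀ w, (wordBasis K n r).repr Y w ≠ 0 → lam.rowWeight w₀ ≤ lam.rowWeight w ∧
        (lam.rowWeight w = lam.rowWeight w₀ →
          ∃ σ : Equiv.Perm (Fin r), (∀ k, lam.rowFin (σ k) = lam.rowFin k) ∧ w = w₀ ∘ σ) := by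
  classical
  set i := lam.rowFin k₀ with hi
  set j := lam.rowFin l₀ with hj
  have hne : i ≠ j := fun h => by rw [h] at hrow; omega
  set κ := w₀ l₀ with hκ
  let H : Fin n → Fin n → Option (Fin n) := fun a b =>
    if a = i then (if b < κ then some i else none)
    else if a = j then (if b ≤ κ then none else some j) else some a
  set h₀ : Fin r → Option (Fin n) := fun k => H (lam.rowFin k) (w₀ k) with hh₀
  -- the three ways in which a label can be moved
  have hH : ∀ a b g : Fin n, splitMatrix K i j (H a b) g ≠ 0 →
      g = a ∨ (g = i ∧ a = j ∧ b ≤ κ) ∨ (g = j ∧ a = i ∧ κ ≤ b) := by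
    intro a b g hg
    simp only [H] at hg
    split_ifs at hg with h1 h2 h3 h4
    · rw [splitMatrix_some] at hg
      exact Or.inl (by simpa [h1] using hg)
    · rw [splitMatrix_none] at hg
      have : g = i ∨ g = j := by by_contra hc; simp [hc] at hg
      rcases this with h | h
      · exact Or.inl (by rw [h, h1])
      · exact Or.inr (Or.inr ⟨h, h1, not_lt.1 h2⟩)
    · rw [splitMatrix_none] at hg
      have : g = i ∨ g = j := by by_contra hc; simp [hc] at hg
      rcases this with h | h
      · exact Or.inr (Or.inl ⟨h, h3, h4⟩)
      · exact Or.inl (by rw [h, h3])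
    · rw [splitMatrix_some] at hg
      exact Or.inl (by simpa [h3] using hg)
    · rw [splitMatrix_some] at hg
      exact Or.inl (by simpa using hg)
  have hH1 : ∀ a b, splitMatrix K i j (H a b) a = 1 := by
    intro a b
    simp only [H]
    split_ifs with h1 h2 h3 h4 <;> simp [splitMatrix_none, splitMatrix_some, *]
  -- movement along a permutation
  have hmove : ∀ (σ : Equiv.Perm (Fin r)),
      (∀ k, splitMatrix K i j (h₀ (σ k)) (lam.rowFin k) ≠ 0) →
      lam.rowWeight w₀ ≤ lam.rowWeight (w₀ ∘ σ) ∧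
      (lam.rowWeight (w₀ ∘ σ) = lam.rowWeight w₀ →
        ∀ k, lam.rowFin k = lam.rowFin (σ k) ∨ w₀ (σ k) = κ) := by
    intro σ hσ
    -- Permuting places preserves the sum of the row indices, so entries may be measured from κ;
    -- then every term is nonnegative.
    have h1 : (lam.rowWeight (w₀ ∘ σ) : ℤ) - lam.rowWeight w₀ = ∑ k,
        ((lam.rowFin k : ℤ) - lam.rowFin (σ k)) * ((w₀ (σ k) : ℤ) - κ) := by
      have h2 : lam.rowWeight w₀ = ∑ k, lam.row (σ k) * w₀ (σ k) :=
        (Equiv.sum_comp σ fun k => lam.row k * (w₀ k : ℕ)).symm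
      have h3 : ∑ k, (lam.rowFin k : ℤ) = ∑ k, (lam.rowFin (σ k) : ℤ) :=
        (Equiv.sum_comp σ fun k => (lam.rowFin k : ℤ)).symm
      have h4 : ∑ k, ((lam.rowFin k : ℤ) - lam.rowFin (σ k)) * (κ : ℤ) = 0 := by
        rw [← Finset.sum_mul, Finset.sum_sub_distrib, h3, sub_self, zero_mul]
      rw [h2, rowWeight]
      simp only [mul_sub, Finset.sum_sub_distrib, h4, sub_zero]
      push_cast
      rw [← Finset.sum_sub_distrib]
      refine Finset.sum_congr rfl fun k _ => ?_
      simp only [row_eq, Function.comp_apply]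
      ring
    have h2 : ∀ k, 0 ≤ ((lam.rowFin k : ℤ) - lam.rowFin (σ k)) * ((w₀ (σ k) : ℤ) - κ) := by
      intro k
      rcases hH _ _ _ (hσ k) with h | ⟨ha, hb, hc⟩ | ⟨ha, hb, hc⟩
      · rw [h, sub_self, zero_mul]
      · rw [ha, hb]
        have : (w₀ (σ k) : ℕ) ≤ κ := hc
        exact mul_nonneg_of_nonpos_of_nonpos (by omega) (by omega)
      · rw [ha, hb]
        have : (κ : ℕ) ≤ w₀ (σ k) := hc
        exact mul_nonneg (by omega) (by omega)
    refine ⟨by have := Finset.sum_nonneg fun k (_ : k ∈ Finset.univ) => h2 k; omega, fun heq k => ?_⟩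
    have h3 := (Finset.sum_eq_zero_iff_of_nonneg fun k _ => h2 k).1
      (h1.symm.trans (by rw [heq, sub_self])) k (Finset.mem_univ k)
    rcases mul_eq_zero.1 h3 with h | h
    · exact Or.inl (Fin.ext (by omega))
    · exact Or.inr (Fin.ext (by omega))
  set T := orbitFamily K w₀ h₀ with hTdef
  have hT : IsFamily T := isFamily_orbitFamily _ _
  have hrepr : ∀ w, (wordBasis K n r).repr (famAct (splitMatrix K i j) T lam.rowFin) w =
      ∑ h : Fin r → Option (Fin n), (∏ k, splitMatrix K i j (h k) (lam.rowFin k)) *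
        if ∃ σ : Equiv.Perm (Fin r), w = w₀ ∘ σ ∧ h = h₀ ∘ σ then 1 else 0 := by
    intro w
    rw [famAct, map_sum, Finsupp.finsetSum_apply]
    refine Finset.sum_congr rfl fun h _ => ?_
    rw [map_smul, Finsupp.smul_apply, hTdef, repr_orbitFamily, smul_eq_mul]
    congr
  refine ⟨famAct (splitMatrix K i j) T lam.rowFin,
    lam.famAct_splitMatrix_mem_relations hrow hT ?_, ?_, ?_⟩
  · intro h hh
    obtain ⟨σ, rfl⟩ := exists_of_orbitFamily_ne_zero hh
    simp only [Function.comp_apply]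
    rw [card_fiber_comp_perm h₀ σ (· = some i), card_fiber_comp_perm h₀ σ (· = some j)]
    have hc : lam.col l₀ < lam.part j := lam.col_lt l₀
    -- As rows are sorted, entries of row i below κ ≤ w₀ k₀ lie strictly left of the violating
    -- column, and entries of row j above κ strictly right of it. The column itself is missed, which
    -- gives the strict inequality.
    have h1 : (Finset.univ.filter fun k => h₀ k = some i).card ≤ lam.col l₀ := by
      rw [← Finset.card_range (lam.col l₀)]
      have hmem : ∀ k, h₀ k = some i → lam.rowFin k = i ∧ w₀ k < κ := by
        intro k hk
        simp only [hh₀, H] at hk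
        split_ifs at hk with h1 h2 h3 h4
        · exact ⟨h1, h2⟩
        · exact absurd (Option.some.inj hk) (Ne.symm hne)
        · exact absurd (Option.some.inj hk) h1
      refine Finset.card_le_card_of_injOn lam.col ?_ ?_
      · intro k hk
        have h1 := hmem k (by simpa using hk)
        simp only [Finset.coe_range, Set.mem_Iio]
        by_contra! h2
        exact absurd (h1.2.trans_le hw)
          (not_lt.2 (hsort k₀ k h1.1.symm (hcol.trans_le h2)))
      · intro k hk l hl hkl
        exact lam.box_injective ((hmem k (by simpa using hk)).1.trans
          (hmem l (by simpa using hl)).1.symm) hkl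
    have h2 : (Finset.univ.filter fun k => h₀ k = some j).card ≤ lam.part j - lam.col l₀ - 1 := by
      rw [← Nat.card_Ioo]
      have hmem : ∀ k, h₀ k = some j → lam.rowFin k = j ∧ κ < w₀ k := by
        intro k hk
        simp only [hh₀, H] at hk
        split_ifs at hk with h1 h2 h3 h4
        · exact absurd (Option.some.inj hk) hne
        · exact ⟨h3, not_le.1 h4⟩
        · exact absurd (Option.some.inj hk) h3
      refine Finset.card_le_card_of_injOn lam.col ?_ ?_
      · intro k hk
        have h1 := hmem k (by simpa using hk)
        simp only [Finset.coe_Ioo, Set.mem_Ioo]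
        refine ⟨?_, by simpa [h1.1] using lam.col_lt k⟩
        by_contra! h2
        exact absurd h1.2 (not_lt.2 (hsort k l₀ h1.1 h2))
      · intro k hk l hl hkl
        exact lam.box_injective ((hmem k (by simpa using hk)).1.trans
          (hmem l (by simpa using hl)).1.symm) hkl
    omega
  -- A σ fixing w₀ keeps the weight, so it moves only entries κ between rows; in rows i and j these
  -- are all labelled `none`. Hence h₀ is the only labelling that contributes to w₀.
  · rw [hrepr, Finset.sum_eq_single h₀]
    · rw [if_pos ⟨1, rfl, rfl⟩, mul_one]
      exact Finset.prod_eq_one fun k _ => hH1 _ _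
    · intro h _ hh
      by_contra hcon
      have hprod := left_ne_zero_of_mul hcon
      have hex : ∃ σ : Equiv.Perm (Fin r), w₀ = w₀ ∘ σ ∧ h = h₀ ∘ σ := by
        by_contra hno; rw [if_neg hno, mul_zero] at hcon; exact hcon rfl
      obtain ⟨σ, hσ1, rfl⟩ := hex
      have hk := Finset.prod_ne_zero_iff.1 hprod
      have h1 := (hmove σ fun k => hk k (Finset.mem_univ k)).2 (by rw [← hσ1])
      refine hh (funext fun k => ?_)
      have hwk : w₀ (σ k) = w₀ k := (congrFun hσ1 k).symm
      rcases h1 k with h2 | h2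
      · simp only [Function.comp_apply, hh₀, hwk, h2]
      · rcases hH _ _ _ (hk k (Finset.mem_univ k)) with h3 | ⟨h3, h4, -⟩ | ⟨h3, h4, -⟩
        · simp only [Function.comp_apply, hh₀, hwk, h3]
        · simp only [Function.comp_apply, hh₀, H, h3, h4, ← hwk, h2]
          simp [hne.symm]
        · simp only [Function.comp_apply, hh₀, H, h3, h4, ← hwk, h2]
          simp [hne.symm]
    · simp
  · intro w hwne
    rw [hrepr] at hwne
    obtain ⟨h, -, hcon⟩ := Finset.exists_ne_zero_of_sum_ne_zero hwne
    have hprod := left_ne_zero_of_mul hcon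
    have hex : ∃ σ : Equiv.Perm (Fin r), w = w₀ ∘ σ ∧ h = h₀ ∘ σ := by
      by_contra hno; rw [if_neg hno, mul_zero] at hcon; exact hcon rfl
    obtain ⟨σ, rfl, rfl⟩ := hex
    have hk := Finset.prod_ne_zero_iff.1 hprod
    obtain ⟨h1, h2⟩ := hmove σ fun k => hk k (Finset.mem_univ k)
    refine ⟨h1, fun heq => ?_⟩
    have h3 := h2 heq
    -- Entries other than κ keep their rows, and the row lengths then fix the number of κ in each
    -- row.
    have hcards : ∀ c : Fin n × Fin n,
        (Finset.univ.filter fun k => (lam.rowFin k, w₀ (σ k)) = c).card =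
        (Finset.univ.filter fun k => (lam.rowFin (σ k), w₀ (σ k)) = c).card := by
      rintro ⟨a, b⟩
      simp only [Prod.mk.injEq]
      have hb : ∀ k, w₀ (σ k) ≠ κ → lam.rowFin k = lam.rowFin (σ k) :=
        fun k hk => (h3 k).resolve_right hk
      by_cases hbκ : b = κ
      · subst hbκ
        have e1 := Finset.card_filter_add_card_filter_not
          (s := Finset.univ.filter fun k => lam.rowFin k = a) (fun k => w₀ (σ k) = κ)
        have e2 := Finset.card_filter_add_card_filter_not
          (s := Finset.univ.filter fun k => lam.rowFin (σ k) = a) (fun k => w₀ (σ k) = κ)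
        rw [Finset.filter_filter, Finset.filter_filter] at e1 e2
        rw [card_fiber_comp_perm lam.rowFin σ (· = a)] at e2
        have e3 : (Finset.univ.filter fun k => lam.rowFin k = a ∧ ¬ w₀ (σ k) = κ) =
            Finset.univ.filter fun k => lam.rowFin (σ k) = a ∧ ¬ w₀ (σ k) = κ := by
          refine Finset.filter_congr fun k _ => ?_
          constructor
          · rintro ⟨h, h'⟩; exact ⟨(hb k h').symm.trans h, h'⟩
          · rintro ⟨h, h'⟩; exact ⟨(hb k h').trans h, h'⟩
        rw [e3] at e1
        omega
      · congr 1
        refine Finset.filter_congr fun k _ => ?_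
        constructor
        · rintro ⟨h, h'⟩; exact ⟨(hb k (h' ▸ hbκ)).symm.trans h, h'⟩
        · rintro ⟨h, h'⟩; exact ⟨(hb k (h' ▸ hbκ)).trans h, h'⟩
    obtain ⟨τ, hτ⟩ := exists_perm_comp_of_card_fiber
      (fun k => (lam.rowFin k, w₀ (σ k))) (fun k => (lam.rowFin k, w₀ k)) fun c => by
        rw [hcards c]
        exact card_fiber_comp_perm (fun k => (lam.rowFin k, w₀ k)) σ (· = c)
    refine ⟨τ, fun k => ?_, funext fun k => ?_⟩
    · exact (congrArg Prod.fst (congrFun hτ k)).symm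
    · exact congrArg Prod.snd (congrFun hτ k)

lemma rowWeight_comp (w : Fin r → Fin n) {σ : Equiv.Perm (Fin r)}
    (hσ : ∀ k, lam.rowFin (σ k) = lam.rowFin k) : lam.rowWeight (w ∘ σ) = lam.rowWeight w := by
  rw [rowWeight, rowWeight, ← Equiv.sum_comp σ fun k => lam.row k * (w k : ℕ)]
  refine Finset.sum_congr rfl fun k _ => ?_
  rw [row_eq, row_eq, hσ]
  rfl

lemma repr_comp_of_mem_dividedPowers {x : TensorSpace K n r}
    (hx : x ∈ dividedPowers (K := K) (n := n) lam.row) (w : Fin r → Fin n)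
    {σ : Equiv.Perm (Fin r)} (hσ : ∀ k, lam.rowFin (σ k) = lam.rowFin k) :
    (wordBasis K n r).repr x (w ∘ σ) = (wordBasis K n r).repr x w := by
  rw [← repr_placePerm, hx σ fun k => by rw [row_eq, row_eq, hσ]]

/-- Exchanging two values of `w` that are out of order increases `∑ c · w`. -/
lemma sum_mul_lt_sum_mul_swap {α : Type*} [Fintype α] [DecidableEq α] (c : α → ℕ) (w : α → ℕ)
    {k l : α} (hc : c k < c l) (hw : w l < w k) :
    ∑ m, c m * w m < ∑ m, c m * w (Equiv.swap k l m) := by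
  have hkl : k ≠ l := by rintro rfl; exact lt_irrefl _ hc
  have h1 : (∑ m, (c m : ℤ) * ((w (Equiv.swap k l m) : ℤ) - w m)) =
      c k * ((w l : ℤ) - w k) + c l * ((w k : ℤ) - w l) := by
    rw [Finset.sum_eq_add k l hkl]
    · simp
    · rintro m - ⟨h1, h2⟩
      rw [Equiv.swap_apply_of_ne_of_ne h1 h2, sub_self, mul_zero]
    · simp
    · simp
  have h2 : (0 : ℤ) < c k * ((w l : ℤ) - w k) + c l * ((w k : ℤ) - w l) := by
    have : (c k : ℤ) * ((w l : ℤ) - w k) + c l * ((w k : ℤ) - w l) =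
      ((c l : ℤ) - c k) * ((w k : ℤ) - w l) := by ring
    rw [this]
    exact mul_pos (by omega) (by omega)
  simp only [mul_sub, Finset.sum_sub_distrib] at h1
  zify
  linarith

/-- The kernel of `d'_λ` is spanned by the relations between adjacent rows. -/
theorem mem_relations {x : TensorSpace K n r}
    (hx : x ∈ dividedPowers (K := K) (n := n) lam.row)
    (hx' : x ∈ alternatingRelations (K := K) (n := n) lam.col) : x ∈ lam.relations K := by
  classical
  obtain ⟨B, hB⟩ : ∃ B, ∀ w : Fin r → Fin n, lam.rowWeight w < B :=
    ⟨Finset.univ.sup lam.rowWeight + 1, fun w =>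
      Nat.lt_succ_of_le (Finset.le_sup (f := lam.rowWeight) (Finset.mem_univ w))⟩
  -- Lexicographic induction: B - N bounds the row weights in the support from below, and c words
  -- attain the bound. A relation lowers c; when c is 0, N drops.
  suffices H : ∀ N c, ∀ x : TensorSpace K n r, x ∈ dividedPowers (K := K) (n := n) lam.row →
      x ∈ alternatingRelations (K := K) (n := n) lam.col →
      (∀ w, (wordBasis K n r).repr x w ≠ 0 → B ≤ lam.rowWeight w + N) →
      (Finset.univ.filter fun w =>
        (wordBasis K n r).repr x w ≠ 0 ∧ lam.rowWeight w + N = B).card = c →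
      x ∈ lam.relations K from
    H B _ x hx hx' (fun w _ => Nat.le_add_left _ _) rfl
  clear hx hx' x
  intro N
  induction N with
  | zero =>
    intro c x _ _ hs _
    have : x = 0 := by
      refine (wordBasis K n r).repr.injective (Finsupp.ext fun w => ?_)
      by_contra hne
      exact absurd (hB w) (not_lt.2 (hs w (by simpa using hne)))
    rw [this]; exact Submodule.zero_mem _
  | succ N ihN =>
    intro c
    induction c using Nat.strong_induction_on with
    | _ c ihc =>
    intro x hx hx' hs hc
    rcases Finset.eq_empty_or_nonempty (Finset.univ.filter fun w =>
        (wordBasis K n r).repr x w ≠ 0 ∧ lam.rowWeight w + (N + 1) = B) with he | hne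
    · refine ihN _ x hx hx' (fun w hw => ?_) rfl
      have h1 := hs w hw
      have h2 : ¬ lam.rowWeight w + (N + 1) = B := fun h => by
        have : w ∈ (∅ : Finset (Fin r → Fin n)) := by
          rw [← he]; exact Finset.mem_filter.2 ⟨Finset.mem_univ _, hw, h⟩
        exact absurd this (Finset.notMem_empty _)
      omega
    -- Maximising ∑ col · w sorts the rows of w₀: exchanging a descent within a row would increase
    -- the sum and stay in the support.
    obtain ⟨w₀, hw₀, hmax⟩ := Finset.exists_max_image _
      (fun w : Fin r → Fin n => ∑ k, lam.col k * (w k : ℕ)) hne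
    obtain ⟨-, hw₀x, hw₀B⟩ := Finset.mem_filter.1 hw₀
    have hsort : ∀ k l, lam.rowFin k = lam.rowFin l → lam.col k ≤ lam.col l → w₀ k ≤ w₀ l := by
      intro k l hkl hcol
      rcases hcol.lt_or_eq with hlt | heq
      swap
      · rw [lam.box_injective hkl heq]
      by_contra! hw
      have hstab : ∀ m, lam.rowFin (Equiv.swap k l m) = lam.rowFin m := apply_swap_of_eq hkl
      refine absurd (hmax (w₀ ∘ Equiv.swap k l) ?_) (not_le.2 ?_)
      · rw [Finset.mem_filter, lam.repr_comp_of_mem_dividedPowers hx _ hstab,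
          lam.rowWeight_comp _ hstab]
        exact ⟨Finset.mem_univ _, hw₀x, hw₀B⟩
      · exact sum_mul_lt_sum_mul_swap lam.col (fun m => (w₀ m : ℕ)) hlt hw
    by_cases hviol : ∃ k₀ l₀, lam.col k₀ = lam.col l₀ ∧
        (lam.rowFin l₀ : ℕ) = lam.rowFin k₀ + 1 ∧ w₀ l₀ ≤ w₀ k₀
    · obtain ⟨k₀, l₀, hcol, hrow, hw⟩ := hviol
      obtain ⟨Y, hY, hY1, hY2⟩ := lam.exists_straightening (K := K) w₀ hsort hcol hrow hw
      set a := (wordBasis K n r).repr x w₀ with ha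
      have hYa : a • Y ∈ lam.relations K := Submodule.smul_mem _ _ hY
      have hrepr : ∀ w, (wordBasis K n r).repr (x - a • Y) w =
          (wordBasis K n r).repr x w - a * (wordBasis K n r).repr Y w := fun w => by
        simp
      have hsupp : ∀ w, (wordBasis K n r).repr (x - a • Y) w ≠ 0 →
          (wordBasis K n r).repr x w ≠ 0 ∨ (wordBasis K n r).repr Y w ≠ 0 := by
        intro w hw
        by_contra! h
        rw [hrepr, h.1, h.2, mul_zero, sub_zero] at hw
        exact hw rfl
      have hmem : x - a • Y ∈ lam.relations K := by
        refine ihc _ ?_ _ (Submodule.sub_mem _ hx (lam.mem_dividedPowers_of_mem_relations hYa))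
          (Submodule.sub_mem _ hx' (lam.mem_alternatingRelations_of_mem_relations hYa)) ?_ rfl
        · rw [← hc]
          -- Words of this weight in Y are row permutations of w₀, hence already in the support of
          -- x; w₀ itself disappears.
          refine Finset.card_lt_card (Finset.ssubset_iff_subset_ne.2 ⟨fun w hw => ?_, fun heq => ?_⟩)
          · obtain ⟨-, hwx, hwB⟩ := Finset.mem_filter.1 hw
            refine Finset.mem_filter.2 ⟨Finset.mem_univ _, ?_, hwB⟩
            rcases hsupp w hwx with h | h
            · exact h
            · obtain ⟨σ, hσ, rfl⟩ := (hY2 w h).2 (by omega)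
              rwa [lam.repr_comp_of_mem_dividedPowers hx _ hσ]
          · rw [← heq] at hw₀
            refine (Finset.mem_filter.1 hw₀).2.1 ?_
            rw [hrepr, hY1, mul_one, sub_self]
        · intro w hw
          rcases hsupp w hw with h | h
          · exact hs w h
          · have := (hY2 w h).1
            omega
      have := Submodule.add_mem _ hmem hYa
      rwa [sub_add_cancel] at this
    · exfalso
      push Not at hviol
      have hstrict : ∀ d k l, lam.col k = lam.col l → (lam.rowFin l : ℕ) = lam.rowFin k + d + 1 →
          w₀ k < w₀ l := by
        intro d
        induction d with
        | zero => exact fun k l h1 h2 => hviol k l h1 h2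
        | succ d ih =>
          intro k l h1 h2
          obtain ⟨m, hm, hm'⟩ := lam.exists_box (c := lam.col k)
            ⟨lam.rowFin k + d + 1, by have := (lam.rowFin l).2; omega⟩ (by
              rw [h1]
              exact (lam.col_lt l).trans_le (lam.antitone (by simp; omega)))
          refine (ih k m hm'.symm (by rw [hm])).trans (hviol m l (hm'.trans h1) ?_)
          rw [hm]
          exact h2
      -- Only τ = 1 survives: a word w₀ ∘ τ in the support has weight at least that of w₀, which
      -- `perm_eq_one_of_sum_le` excludes for other column permutations.
      have hform := columnForm_eq_zero w₀ hx'
      rw [columnForm_apply, Finset.sum_eq_single 1] at hform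
      · simp at hform
        exact hw₀x hform
      · intro τ _ hτ
        split_ifs with hcol
        swap
        · rfl
        by_contra hne
        have h1 := hs _ (right_ne_zero_of_mul hne)
        refine hτ (perm_eq_one_of_sum_le lam.row lam.col (fun k => (w₀ k : ℕ))
          (fun k => (lam.rowFin k).2) (fun k => (w₀ k).2)
          (fun k l h h' => lam.box_injective (Fin.ext h) h') ?_ τ hcol ?_)
        · intro k l h h'
          rw [row_eq, row_eq] at h'
          exact hstrict (lam.rowFin l - lam.rowFin k - 1) k l h (by omega)
        · have h2 : lam.rowWeight w₀ ≤ lam.rowWeight (w₀ ∘ τ) := by omega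
          exact h2
      · simp

end PartitionOf

end

/-! ### Maps D(λ) → D(μ) from sets of labellings, and their values on relations -/

noncomputable section

namespace PartitionOf

variable {n r : ℕ} (lam mu : PartitionOf n r) {K : Type*} [Field K]

/-- Labellings of the places with the content of the filling by rows. -/
def HasContent (g : Fin r → Fin n) : Prop := ∃ σ : Equiv.Perm (Fin r), g = lam.rowFin ∘ σ

variable {lam} in
lemma HasContent.comp {g : Fin r → Fin n} (hg : lam.HasContent g) (τ : Equiv.Perm (Fin r)) :
    lam.HasContent (g ∘ τ) := by
  obtain ⟨σ, rfl⟩ := hg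
  exact ⟨σ * τ, rfl⟩

lemma hasContent_iff {g : Fin r → Fin n} :
    lam.HasContent g ↔ ∀ c : Fin n, (Finset.univ.filter fun k => g k = c).card = lam.part c := by
  constructor
  · rintro ⟨σ, rfl⟩ c
    rw [← lam.card_rowFin c]
    exact card_fiber_comp_perm lam.rowFin σ (· = c)
  · intro h
    exact exists_perm_comp_of_card_fiber _ _ fun c => by rw [h, lam.card_rowFin]

/-- The place permutation `σ` as an `S`-linear map. -/
def placePermHom (K : Type*) [Field K] (n : ℕ) {r : ℕ} (σ : Equiv.Perm (Fin r)) :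
    TensorSpace K n r →ₗ[SchurAlgebra K n r] TensorSpace K n r where
  toFun := placePerm K n r σ
  map_add' := map_add _
  map_smul' s x := placePerm_smul s σ x

open Classical in
/-- The sum, over all labellings `g` of content `λ` with property `P`, of the place permutations
that carry the filling by rows to `g`. -/
def spreadMap (K : Type*) [Field K] (P : (Fin r → Fin n) → Prop) :
    TensorSpace K n r →ₗ[SchurAlgebra K n r] TensorSpace K n r :=
  ∑ g : Fin r → Fin n, if h : lam.HasContent g ∧ P g then placePermHom K n h.1.choose.symm else 0

-- Equivariance of T makes the chosen permutation irrelevant: each choice carries T `lam.rowFin` to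
-- T g.
open Classical in
lemma spreadMap_family (P : (Fin r → Fin n) → Prop) {T : (Fin r → Fin n) → TensorSpace K n r}
    (hT : IsFamily T) :
    lam.spreadMap K P (T lam.rowFin) = ∑ g, if lam.HasContent g ∧ P g then T g else 0 := by
  rw [spreadMap, LinearMap.sum_apply]
  refine Finset.sum_congr rfl fun g _ => ?_
  split_ifs with h
  · refine (hT _ _).trans ?_
    rw [Equiv.symm_symm, ← h.1.choose_spec]
  · rfl

/-- Invariance of x under row permutations is what makes its transport to another labelling of
content λ well defined; elsewhere the family is zero. -/
lemma exists_family {x : TensorSpace K n r} (hx : x ∈ dividedPowers (K := K) (n := n) lam.row) :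
    ∃ T : (Fin r → Fin n) → TensorSpace K n r, IsFamily T ∧ T lam.rowFin = x := by
  classical
  let T : (Fin r → Fin n) → TensorSpace K n r := fun g =>
    if h : lam.HasContent g then placePerm K n r h.choose.symm x else 0
  have hTσ : ∀ σ : Equiv.Perm (Fin r), T (lam.rowFin ∘ σ) = placePerm K n r σ.symm x := by
    intro σ
    have h : lam.HasContent (lam.rowFin ∘ σ) := ⟨σ, rfl⟩
    have h1 : T (lam.rowFin ∘ σ) = placePerm K n r h.choose.symm x := dif_pos h
    have h2 := h.choose_spec
    generalize h.choose = τ at h1 h2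
    rw [h1]
    have h3 : placePerm K n r (σ * τ.symm) x = x := hx _ fun k => by
      rw [row_eq, row_eq]
      have := congrFun h2 (τ.symm k)
      simp only [Function.comp_apply, Equiv.apply_symm_apply] at this
      rw [Equiv.Perm.mul_apply, this]
    conv_rhs => rw [← h3]
    rw [← placePerm_mul, show σ.symm * (σ * τ.symm) = τ.symm from inv_mul_cancel_left σ _]
  refine ⟨T, fun σ g => ?_, ?_⟩
  · by_cases hg : lam.HasContent g
    · obtain ⟨τ, rfl⟩ := hg
      have := hTσ (σ.symm.trans τ)
      rw [hTσ, ← placePerm_mul]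
      exact this.symm
    · have h1 : T g = 0 := dif_neg hg
      have h2 : T (g ∘ σ.symm) = 0 := dif_neg fun h => hg (by
        have := h.comp σ
        rwa [Function.comp_assoc, Equiv.symm_comp_self, Function.comp_id] at this)
      rw [h1, h2, map_zero]
  · have := hTσ 1
    rw [Equiv.Perm.coe_one, Function.comp_id] at this
    rw [this]
    have := hx 1 fun _ => rfl
    exact this

lemma spreadMap_mem_dividedPowers {P : (Fin r → Fin n) → Prop}
    (hP : ∀ τ : Equiv.Perm (Fin r), (∀ k, mu.row (τ k) = mu.row k) → ∀ g, P (g ∘ τ) ↔ P g)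
    {x : TensorSpace K n r} (hx : x ∈ dividedPowers (K := K) (n := n) lam.row) :
    lam.spreadMap K P x ∈ dividedPowers (K := K) (n := n) mu.row := by
  classical
  obtain ⟨T, hT, rfl⟩ := lam.exists_family hx
  rw [lam.spreadMap_family P hT]
  intro τ hτ
  rw [map_sum]
  refine Fintype.sum_equiv (Equiv.arrowCongr τ (Equiv.refl _)) _ _ fun g => ?_
  have hg : (Equiv.arrowCongr τ (Equiv.refl _)) g = g ∘ τ.symm := rfl
  rw [apply_ite (placePerm K n r τ), map_zero, hT, hg]
  refine if_congr (and_congr ⟨fun h => h.comp _, fun h => ?_⟩ ?_) rfl rfl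
  · have := h.comp τ
    rwa [Function.comp_assoc, Equiv.symm_comp_self, Function.comp_id] at this
  · rw [← hP τ hτ (g ∘ τ.symm), Function.comp_assoc, Equiv.symm_comp_self, Function.comp_id]

/-- The projection `D(λ) → Δ(λ)`. -/
def toWeyl (K : Type*) [Field K] :
    dividedPowers (K := K) (n := n) lam.row →ₗ[SchurAlgebra K n r] lam.weyl K :=
  (lam.dMap K).rangeRestrict

/-- If a spreading map sends the relations of `Δ(λ)` to alternating relations, it induces a
homomorphism `Δ(λ) → Δ(μ)`. -/
lemma exists_hom {P : (Fin r → Fin n) → Prop}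
    (hP : ∀ τ : Equiv.Perm (Fin r), (∀ k, mu.row (τ k) = mu.row k) → ∀ g, P (g ∘ τ) ↔ P g)
    (hrel : ∀ x ∈ lam.relations K,
      lam.spreadMap K P x ∈ alternatingRelations (K := K) (n := n) mu.col) :
    ∃ Ψ : lam.weyl K →ₗ[SchurAlgebra K n r] mu.weyl K,
      ∀ x : dividedPowers (K := K) (n := n) lam.row,
        ((Ψ (lam.toWeyl K x) : mu.weyl K) : exteriorPowers K n mu.col) =
          (alternatingRelations mu.col).mkQ (lam.spreadMap K P x) := by
  let φ : dividedPowers (K := K) (n := n) lam.row →ₗ[SchurAlgebra K n r] mu.weyl K :=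
    mu.toWeyl K ∘ₗ
      ((lam.spreadMap K P ∘ₗ (dividedPowers (K := K) (n := n) lam.row).subtype).codRestrict _
        fun x => lam.spreadMap_mem_dividedPowers mu hP x.2)
  have hφ : ∀ x, ((φ x : mu.weyl K) : exteriorPowers K n mu.col) =
      (alternatingRelations mu.col).mkQ (lam.spreadMap K P x) := fun x => rfl
  have hker : LinearMap.ker (lam.dMap K) ≤ LinearMap.ker φ := by
    intro x hx
    rw [LinearMap.mem_ker] at hx ⊢
    have hx' : (x : TensorSpace K n r) ∈ alternatingRelations (K := K) (n := n) lam.col :=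
      (Submodule.Quotient.mk_eq_zero _).1 hx
    refine Subtype.ext ?_
    rw [hφ]
    exact (Submodule.Quotient.mk_eq_zero _).2 (hrel _ (lam.mem_relations x.2 hx'))
  let e : lam.weyl K →ₗ[SchurAlgebra K n r] _ ⧸ LinearMap.ker (lam.dMap K) :=
    (lam.dMap K).quotKerEquivRange.symm.toLinearMap
  have he : ∀ x, e (lam.toWeyl K x) = (LinearMap.ker (lam.dMap K)).mkQ x := fun x =>
    (lam.dMap K).quotKerEquivRange.symm_apply_apply ((LinearMap.ker (lam.dMap K)).mkQ x)
  refine ⟨(LinearMap.ker (lam.dMap K)).liftQ φ hker ∘ₗ e, fun x => ?_⟩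
  rw [LinearMap.comp_apply, he, Submodule.mkQ_apply, Submodule.liftQ_apply, hφ]

/-- `h` becomes `g` when some labels `i` are replaced by `j`. -/
def Lowers {n r : ℕ} (i j : Fin n) (h g : Fin r → Fin n) : Prop :=
  ∀ k, g k = h k ∨ h k = i ∧ g k = j

/-- The number of labellings of content `λ` with property `P` to which `h` can be lowered. -/
def lowerCount (P : (Fin r → Fin n) → Prop) (i j : Fin n) (h : Fin r → Fin n) : ℕ :=
  open Classical in
  (Finset.univ.filter fun g => lam.HasContent g ∧ P g ∧ Lowers i j h g).card

/-- Exchanging the two sums reduces the vanishing of relations to the integers `lowerCount`, which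
the divisibility hypotheses control. -/
lemma sum_famAct_transvection (P : (Fin r → Fin n) → Prop) {i j : Fin n} (hij : i ≠ j)
    {T : (Fin r → Fin n) → TensorSpace K n r} (hT : IsFamily T) :
    lam.spreadMap K P (famAct (Matrix.transvection i j (1 : K)) T lam.rowFin) =
      ∑ h, (lam.lowerCount P i j h : K) • T h := by
  classical
  rw [lam.spreadMap_family P (hT.famAct _)]
  simp only [famAct_transvection hij]
  have : ∀ g, (if lam.HasContent g ∧ P g then
      ∑ h : Fin r → Fin n, if ∀ k, g k = h k ∨ h k = i ∧ g k = j then T h else 0 else 0) =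
      ∑ h : Fin r → Fin n, if lam.HasContent g ∧ P g ∧ Lowers i j h g then T h else 0 := by
    intro g
    split_ifs with hg
    · refine Finset.sum_congr rfl fun h _ => if_congr ?_ rfl rfl
      simp only [hg, true_and]
      rfl
    · refine (Finset.sum_eq_zero fun h _ => if_neg fun hh => hg ⟨hh.1, hh.2.1⟩).symm
  simp only [this]
  rw [Finset.sum_comm]
  refine Finset.sum_congr rfl fun h _ => ?_
  rw [← Finset.sum_filter, Finset.sum_const, lowerCount, Nat.cast_smul_eq_nsmul]

/-- The labelling `h` with the labels at the places in `S` replaced by `j`. -/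
def relabel {n r : ℕ} (j : Fin n) (h : Fin r → Fin n) (S : Finset (Fin r)) (k : Fin r) : Fin n :=
  if k ∈ S then j else h k

lemma relabel_of_mem {j : Fin n} {h : Fin r → Fin n} {S : Finset (Fin r)} {k : Fin r}
    (hk : k ∈ S) : relabel j h S k = j := if_pos hk

lemma relabel_of_notMem {j : Fin n} {h : Fin r → Fin n} {S : Finset (Fin r)} {k : Fin r}
    (hk : k ∉ S) : relabel j h S k = h k := if_neg hk

lemma card_relabel {i j : Fin n} (hij : i ≠ j) {h : Fin r → Fin n} {S : Finset (Fin r)}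
    (hS : S ⊆ Finset.univ.filter fun k => h k = i) (c : Fin n) :
    (Finset.univ.filter fun k => relabel j h S k = c).card + (if c = i then S.card else 0) =
      (Finset.univ.filter fun k => h k = c).card + (if c = j then S.card else 0) := by
  have hS' : ∀ k ∈ S, h k = i := fun k hk => (Finset.mem_filter.1 (hS hk)).2
  by_cases hci : c = i
  · subst hci
    have e : (Finset.univ.filter fun k => relabel j h S k = c) =
        (Finset.univ.filter fun k => h k = c) \ S := by
      ext k
      by_cases hk : k ∈ S
      · simp [relabel_of_mem hk, hk, hij.symm]
      · simp [relabel_of_notMem hk, hk]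
    rw [if_pos rfl, if_neg hij, add_zero, e, Finset.card_sdiff_add_card_eq_card hS]
  by_cases hcj : c = j
  · subst hcj
    rw [if_pos rfl, if_neg hci, add_zero, ← Finset.card_union_of_disjoint]
    · congr 1
      ext k
      by_cases hk : k ∈ S
      · simp [relabel_of_mem hk, hk]
      · simp [relabel_of_notMem hk, hk]
    · rw [Finset.disjoint_right]
      intro k hk hk'
      exact hij ((hS' k hk).symm.trans (Finset.mem_filter.1 hk').2)
  · rw [if_neg hci, if_neg hcj]
    have e : (Finset.univ.filter fun k => relabel j h S k = c) =
        Finset.univ.filter fun k => h k = c := by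
      refine Finset.filter_congr fun k _ => ?_
      by_cases hk : k ∈ S
      · simp [relabel_of_mem hk, hS' k hk, Ne.symm hci, Ne.symm hcj]
      · simp [relabel_of_notMem hk]
    rw [e]

lemma Lowers.exists_relabel {i j : Fin n} {h g : Fin r → Fin n} (hg : Lowers i j h g) :
    ∃ S ⊆ Finset.univ.filter fun k => h k = i, relabel j h S = g := by
  refine ⟨Finset.univ.filter fun k => g k ≠ h k, fun k hk => ?_, funext fun k => ?_⟩
  · have := (Finset.mem_filter.1 hk).2
    exact Finset.mem_filter.2 ⟨Finset.mem_univ _, ((hg k).resolve_left this).1⟩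
  · rcases hg k with h1 | h1
    · simp [relabel, h1]
    · by_cases h2 : g k = h k
      · simp [relabel, h2]
      · exact (relabel_of_mem (by simpa using h2)).trans h1.2.symm

lemma lowers_relabel {i j : Fin n} {h : Fin r → Fin n} {S : Finset (Fin r)}
    (hS : S ⊆ Finset.univ.filter fun k => h k = i) : Lowers i j h (relabel j h S) := by
  intro k
  by_cases hk : k ∈ S
  · exact Or.inr ⟨(Finset.mem_filter.1 (hS hk)).2, if_pos hk⟩
  · exact Or.inl (if_neg hk)

lemma relabel_injective {i j : Fin n} (hij : i ≠ j) {h : Fin r → Fin n} {S S' : Finset (Fin r)}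
    (hS : S ⊆ Finset.univ.filter fun k => h k = i) (hS' : S' ⊆ Finset.univ.filter fun k => h k = i)
    (heq : relabel j h S = relabel j h S') : S = S' := by
  have key : ∀ S : Finset (Fin r), S ⊆ (Finset.univ.filter fun k => h k = i) →
      ∀ k, k ∈ S ↔ h k = i ∧ relabel j h S k = j := by
    intro S hS k
    constructor
    · exact fun hk => ⟨(Finset.mem_filter.1 (hS hk)).2, if_pos hk⟩
    · rintro ⟨h1, h2⟩
      by_contra hk
      rw [relabel, if_neg hk, h1] at h2
      exact hij h2
  ext k
  rw [key S hS, key S' hS', heq]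

open Classical in
/-- If `h` can be lowered to content `λ`, then this is done by choosing a subset of fixed size `t`
of the places labelled `i`. -/
lemma exists_lowerCount {i j : Fin n} (hij : i ≠ j) {h : Fin r → Fin n}
    (hW : ∃ g, lam.HasContent g ∧ Lowers i j h g) :
    ∃ t, t ≤ lam.part j ∧ (t = 0 → lam.HasContent h) ∧
      (∀ c, (Finset.univ.filter fun k => h k = c).card + (if c = j then t else 0) =
        lam.part c + (if c = i then t else 0)) ∧
      ∀ P : (Fin r → Fin n) → Prop, lam.lowerCount P i j h =
        ((Finset.powersetCard t (Finset.univ.filter fun k => h k = i)).filter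
          fun S => P (relabel j h S)).card := by
  obtain ⟨g, hg, hgl⟩ := hW
  obtain ⟨S₀, hS₀, rfl⟩ := hgl.exists_relabel
  have hc : ∀ c, (Finset.univ.filter fun k => h k = c).card + (if c = j then S₀.card else 0) =
        lam.part c + (if c = i then S₀.card else 0) := fun c => by
    rw [← card_relabel hij hS₀, lam.hasContent_iff.1 hg]
  refine ⟨S₀.card, ?_, ?_, hc, fun P => ?_⟩
  · have := hc j
    rw [if_pos rfl, if_neg hij.symm] at this
    omega
  · intro h0
    rw [Finset.card_eq_zero] at h0
    subst h0
    exact hg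
  · symm
    refine Finset.card_bij (fun S _ => relabel j h S) ?_ ?_ ?_
    · intro S hS
      obtain ⟨hS, hPS⟩ := Finset.mem_filter.1 hS
      obtain ⟨hS, hcard⟩ := Finset.mem_powersetCard.1 hS
      refine Finset.mem_filter.2 ⟨Finset.mem_univ _, lam.hasContent_iff.2 fun c => ?_, hPS,
        lowers_relabel hS⟩
      have h1 := card_relabel hij hS c
      have h2 := hc c
      rw [hcard] at h1
      omega
    · intro S hS S' hS' heq
      exact relabel_injective hij (Finset.mem_powersetCard.1 (Finset.mem_filter.1 hS).1).1
        (Finset.mem_powersetCard.1 (Finset.mem_filter.1 hS').1).1 heq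
    · intro g hg
      obtain ⟨-, hg1, hg2, hg3⟩ := Finset.mem_filter.1 hg
      obtain ⟨S, hS, rfl⟩ := hg3.exists_relabel
      refine ⟨S, Finset.mem_filter.2 ⟨Finset.mem_powersetCard.2 ⟨hS, ?_⟩, hg2⟩, rfl⟩
      have h1 := card_relabel hij hS i
      have h2 := hc i
      rw [lam.hasContent_iff.1 hg1, if_pos rfl, if_neg hij] at h1
      rw [if_neg hij, if_pos rfl] at h2
      omega

lemma lowerCount_eq_zero {P : (Fin r → Fin n) → Prop} {i j : Fin n} {h : Fin r → Fin n}
    (hW : ¬ ∃ g, lam.HasContent g ∧ Lowers i j h g) : lam.lowerCount P i j h = 0 := by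
  classical
  rw [lowerCount, Finset.card_eq_zero, Finset.filter_eq_empty_iff]
  rintro g - ⟨h1, -, h2⟩
  exact hW ⟨g, h1, h2⟩

end PartitionOf

end

/-! ### Counting admissible lowerings -/

noncomputable section

/-- Vandermonde's identity; the guard e ≤ s removes terms in which truncated subtraction would give
the value 1. -/
lemma sum_choose_mul_choose_sub (b m s : ℕ) :
    ∑ e ∈ Finset.range (b + 1), b.choose e * (if e ≤ s then m.choose (s - e) else 0) =
      (b + m).choose s := by
  rw [Nat.add_choose_eq, Finset.Nat.sum_antidiagonal_eq_sum_range_succ_mk]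
  have h1 : ∑ e ∈ Finset.range (b + 1), b.choose e * (if e ≤ s then m.choose (s - e) else 0) =
      ∑ e ∈ Finset.range (b + s + 1), b.choose e * (if e ≤ s then m.choose (s - e) else 0) := by
    refine Finset.sum_subset (Finset.range_mono (by omega)) fun e _ he => ?_
    rw [Nat.choose_eq_zero_of_lt (by simpa using he), zero_mul]
  have h2 : ∑ e ∈ Finset.range (s + 1), b.choose e * m.choose (s - e) =
      ∑ e ∈ Finset.range (s + 1), b.choose e * (if e ≤ s then m.choose (s - e) else 0) :=
    Finset.sum_congr rfl fun e he => by
      rw [if_pos (Nat.lt_succ_iff.1 (Finset.mem_range.1 he))]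
  rw [h1, h2]
  symm
  refine Finset.sum_subset (Finset.range_mono (by omega)) fun e _ he => ?_
  have : ¬ e ≤ s := by simp at he; omega
  rw [if_neg this, mul_zero]

/-- Pass to complements: S corresponds to an a-subset of A ∩ R. It is applied to the places that
keep the label 0, which must lie in the first row. -/
lemma card_filter_sdiff_subset {α : Type*} [DecidableEq α] (A R : Finset α) {a t : ℕ}
    (hA : A.card = a + t) :
    ((Finset.powersetCard t A).filter fun S => A \ S ⊆ R).card = (A ∩ R).card.choose a := by
  rw [← Finset.card_powersetCard]
  refine Finset.card_nbij' (fun S => A \ S) (fun Z => A \ Z) ?_ ?_ ?_ ?_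
  · intro S hS
    obtain ⟨hS, hR⟩ := Finset.mem_filter.1 (Finset.mem_coe.1 hS)
    obtain ⟨hSA, hSt⟩ := Finset.mem_powersetCard.1 hS
    refine Finset.mem_coe.2 (Finset.mem_powersetCard.2
      ⟨Finset.subset_inter Finset.sdiff_subset hR, ?_⟩)
    rw [Finset.card_sdiff_of_subset hSA]; omega
  · intro Z hZ
    obtain ⟨hZA, hZt⟩ := Finset.mem_powersetCard.1 (Finset.mem_coe.1 hZ)
    have hZA' := hZA.trans Finset.inter_subset_left
    refine Finset.mem_coe.2 (Finset.mem_filter.2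
      ⟨Finset.mem_powersetCard.2 ⟨Finset.sdiff_subset, ?_⟩, ?_⟩)
    · rw [Finset.card_sdiff_of_subset hZA']; omega
    · rw [Finset.sdiff_sdiff_eq_self hZA']
      exact hZA.trans Finset.inter_subset_right
  · intro S hS
    obtain ⟨hS, -⟩ := Finset.mem_filter.1 (Finset.mem_coe.1 hS)
    exact Finset.sdiff_sdiff_eq_self (Finset.mem_powersetCard.1 hS).1
  · intro Z hZ
    obtain ⟨hZA, -⟩ := Finset.mem_powersetCard.1 (Finset.mem_coe.1 hZ)
    exact Finset.sdiff_sdiff_eq_self (hZA.trans Finset.inter_subset_left)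

namespace PartitionOf

variable {n r : ℕ} (lam mu : PartitionOf n r) {K : Type*} [Field K]

/-- The labellings with label `0` only in the first row of `μ`, and with labels satisfying `C`
throughout that row. -/
def FirstRow (C : Fin n → Prop) (g : Fin r → Fin n) : Prop :=
  (∀ k, (g k : ℕ) = 0 → mu.row k = 0) ∧ ∀ k, mu.row k = 0 → C (g k)

lemma firstRow_comp (C : Fin n → Prop) {τ : Equiv.Perm (Fin r)}
    (hτ : ∀ k, mu.row (τ k) = mu.row k) (g : Fin r → Fin n) :
    mu.FirstRow C (g ∘ τ) ↔ mu.FirstRow C g := by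
  have key : ∀ (σ : Equiv.Perm (Fin r)) (g : Fin r → Fin n),
      (∀ k, mu.row (σ k) = mu.row k) → mu.FirstRow C g → mu.FirstRow C (g ∘ σ) :=
    fun σ g hσ hg => ⟨fun k hk => (hσ k).symm.trans (hg.1 _ hk),
      fun k hk => hg.2 _ ((hσ k).trans hk)⟩
  refine ⟨fun h => ?_, key τ g hτ⟩
  have := key τ.symm _ (fun k => by rw [← hτ, Equiv.apply_symm_apply]) h
  rwa [Function.comp_assoc, Equiv.self_comp_symm, Function.comp_id] at this

lemma HasContent.family_eq_zero {lam : PartitionOf n r} {h : Fin r → Fin n}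
    (hh : lam.HasContent h) {T : (Fin r → Fin n) → TensorSpace K n r} (hT : IsFamily T)
    (hT0 : T lam.rowFin = 0) : T h = 0 := by
  obtain ⟨σ, rfl⟩ := hh
  exact hT.eq_zero hT0 σ

/-- Lowering a label that is free in the part of `μ` where it occurs contributes binomial
coefficients. -/
lemma lowerCount_smul_eq_zero {C : Fin n → Prop} {i j : Fin n} (hij : i ≠ j)
    (hi : (i : ℕ) ≠ 0) (hj : (j : ℕ) ≠ 0) (hC : C i ↔ C j)
    (hbin : ∀ t, 1 ≤ t → t ≤ lam.part j → (((lam.part i + t).choose t : ℕ) : K) = 0)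
    {T : (Fin r → Fin n) → TensorSpace K n r} (hT : IsFamily T) (hT0 : T lam.rowFin = 0)
    (h : Fin r → Fin n) : (lam.lowerCount (mu.FirstRow C) i j h : K) • T h = 0 := by
  classical
  by_cases hW : ∃ g, lam.HasContent g ∧ Lowers i j h g
  swap
  · rw [lam.lowerCount_eq_zero hW, Nat.cast_zero, zero_smul]
  obtain ⟨t, htj, ht0, hc, hcount⟩ := lam.exists_lowerCount hij hW
  rcases Nat.eq_zero_or_pos t with h0 | hpos
  · rw [(ht0 h0).family_eq_zero hT hT0, smul_zero]
  -- Admissibility does not distinguish i from j, so either all or none of the t-subsets of the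
  -- `lam.part i + t` places count.
  have hP : ∀ S ∈ Finset.powersetCard t (Finset.univ.filter fun k => h k = i),
      (mu.FirstRow C (relabel j h S) ↔ mu.FirstRow C h) := by
    intro S hS
    have hS' : ∀ k ∈ S, h k = i := fun k hk =>
      (Finset.mem_filter.1 ((Finset.mem_powersetCard.1 hS).1 hk)).2
    refine and_congr (forall_congr' fun k => ?_) (forall_congr' fun k => ?_)
    · by_cases hk : k ∈ S
      · rw [relabel_of_mem hk, hS' k hk]; simp [hi, hj]
      · rw [relabel_of_notMem hk]
    · by_cases hk : k ∈ S
      · rw [relabel_of_mem hk, hS' k hk, hC]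
      · rw [relabel_of_notMem hk]
  have hci := hc i
  rw [if_neg hij, if_pos rfl, add_zero] at hci
  rw [hcount, Finset.filter_congr hP]
  by_cases hh : mu.FirstRow C h
  · rw [Finset.filter_true_of_mem fun _ _ => hh, Finset.card_powersetCard, hci, hbin t hpos htj,
      zero_smul]
  · rw [Finset.filter_false_of_mem fun _ _ => hh, Finset.card_empty, Nat.cast_zero, zero_smul]

/-- Lowering a label, of a kind that in the first row of `μ` occupies all places not labelled `0`,
to one that is forbidden there. -/
lemma lowerCount_smul_eq_zero_of_boundary {C : Fin n → Prop} {z i j : Fin n} (hz : (z : ℕ) = 0)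
    (hij : i ≠ j) (hi : (i : ℕ) ≠ 0) (hj : (j : ℕ) ≠ 0) (hC : ∀ c, C c ↔ c = z ∨ c = i)
    {d : ℕ} (hd : mu.part 0 = lam.part 0 + d) (hdi : d ≤ lam.part i)
    (hbin : ∀ t, 1 ≤ t → t ≤ lam.part j → (((lam.part i - d + t).choose t : ℕ) : K) = 0)
    {T : (Fin r → Fin n) → TensorSpace K n r} (hT : IsFamily T) (hT0 : T lam.rowFin = 0)
    (h : Fin r → Fin n) : (lam.lowerCount (mu.FirstRow C) i j h : K) • T h = 0 := by
  classical
  have hzi : z ≠ i := fun e => hi (e ▸ hz)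
  have hzj : z ≠ j := fun e => hj (e ▸ hz)
  by_cases hW : ∃ g, lam.HasContent g ∧ Lowers i j h g
  swap
  · rw [lam.lowerCount_eq_zero hW, Nat.cast_zero, zero_smul]
  obtain ⟨t, htj, ht0, hc, hcount⟩ := lam.exists_lowerCount hij hW
  rcases Nat.eq_zero_or_pos t with h0 | hpos
  · rw [(ht0 h0).family_eq_zero hT hT0, smul_zero]
  set A := Finset.univ.filter fun k => h k = i with hA
  set R := Finset.univ.filter fun k => mu.rowFin k = z with hR
  have hRrow : ∀ k, k ∈ R ↔ mu.row k = 0 := fun k => by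
    simp only [hR, Finset.mem_filter, Finset.mem_univ, true_and, row_eq, Fin.ext_iff, hz]
  have hRcard : R.card = lam.part 0 + d := by rw [hR, mu.card_rowFin, hz, hd]
  have hP : ∀ S ∈ Finset.powersetCard t A,
      (mu.FirstRow C (relabel j h S) ↔ mu.FirstRow C h ∧ Disjoint S R) := by
    intro S hS
    have hS' : ∀ k ∈ S, h k = i := fun k hk =>
      (Finset.mem_filter.1 ((Finset.mem_powersetCard.1 hS).1 hk)).2
    rw [FirstRow, FirstRow, and_assoc]
    refine and_congr (forall_congr' fun k => ?_) ?_
    · by_cases hk : k ∈ S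
      · rw [relabel_of_mem hk, hS' k hk]; simp [hi, hj]
      · rw [relabel_of_notMem hk]
    · rw [Finset.disjoint_left, ← forall_and]
      refine forall_congr' fun k => ?_
      rw [hRrow]
      by_cases hk : k ∈ S
      · rw [relabel_of_mem hk, hS' k hk]
        have : ¬ C j := by rw [hC]; rintro (e | e); exacts [hzj e.symm, hij e.symm]
        have : C i := by rw [hC]; exact Or.inr rfl
        tauto
      · rw [relabel_of_notMem hk]
        tauto
  have hci := hc i
  have hcz := hc z
  rw [if_neg hij, if_pos rfl, add_zero] at hci
  change A.card = _ at hci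
  rw [if_neg hzi, if_neg hzj, add_zero, add_zero] at hcz
  rw [hcount, Finset.filter_congr hP]
  by_cases hh : mu.FirstRow C h
  · have hset : ((Finset.powersetCard t A).filter fun S => mu.FirstRow C h ∧ Disjoint S R) =
        Finset.powersetCard t (A \ R) := by
      ext S
      simp only [Finset.mem_filter, Finset.mem_powersetCard, hh, true_and, Finset.subset_sdiff]
      tauto
    -- The first row has `lam.part 0 + d` places and contains all `lam.part 0` labels z, hence
    -- exactly d labels i, none of which may be lowered.
    have hAR : (A \ R).card = lam.part i - d + t := by
      have h1 : R = (Finset.univ.filter fun k => h k = z) ∪ (A ∩ R) := by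
        ext k
        simp only [Finset.mem_union, Finset.mem_inter, hA, Finset.mem_filter, Finset.mem_univ,
          true_and]
        constructor
        · intro hk
          rcases (hC _).1 (hh.2 k ((hRrow k).1 hk)) with h2 | h2
          · exact Or.inl h2
          · exact Or.inr ⟨h2, hk⟩
        · rintro (h2 | h2)
          · exact (hRrow k).2 (hh.1 k (by rw [h2, hz]))
          · exact h2.2
      have h2 : Disjoint (Finset.univ.filter fun k => h k = z) (A ∩ R) := by
        rw [Finset.disjoint_left]
        intro k hk hk'
        exact hzi ((Finset.mem_filter.1 hk).2.symm.trans
          (Finset.mem_filter.1 (Finset.mem_inter.1 hk').1).2)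
      have h3 := congrArg Finset.card h1
      rw [Finset.card_union_of_disjoint h2, hcz, hRcard, hz] at h3
      have h4 := Finset.card_sdiff_add_card_inter A R
      omega
    rw [hset, Finset.card_powersetCard, hAR, hbin t hpos htj, zero_smul]
  · rw [Finset.filter_false_of_mem fun _ _ hx => hh hx.1, Finset.card_empty, Nat.cast_zero,
      zero_smul]

/-- Lowering the label `0`: here the relations of `Δ(μ)` enter. -/
lemma sum_lowerCount_mem {C : Fin n → Prop} {i j : Fin n} (hi : (i : ℕ) = 0) (hij : i ≠ j)
    (hCi : C i) (hCj : C j)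
    {d B D : ℕ} (hd : mu.part 0 = lam.part 0 + d)
    (hB : ∀ h : Finset (Fin r), (∀ k, k ∈ h ↔ C (lam.rowFin k)) → h.card = mu.part 0 + B)
    (hD : D + B = lam.part 0)
    (hbin : ∀ t, 1 ≤ t → t ≤ d → (((D + t).choose t : ℕ) : K) = 0)
    {T : (Fin r → Fin n) → TensorSpace K n r} (hT : IsFamily T) (hT0 : T lam.rowFin = 0) :
    ∑ h, (lam.lowerCount (mu.FirstRow C) i j h : K) • T h ∈
      alternatingRelations (K := K) (n := n) mu.col := by
  classical
  set R₀ := Finset.univ.filter fun k => mu.rowFin k = i with hR₀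
  have hRrow : ∀ k, k ∈ R₀ ↔ mu.row k = 0 := fun k => by
    simp only [hR₀, Finset.mem_filter, Finset.mem_univ, true_and, row_eq, Fin.ext_iff, hi]
  have hRcard : R₀.card = lam.part 0 + d := by rw [hR₀, mu.card_rowFin, hi, hd]
  let W : (Fin r → Fin n) → Prop := fun h => ∃ g, lam.HasContent g ∧ Lowers i j h g
  let tt : (Fin r → Fin n) → ℕ := fun h => (Finset.univ.filter fun k => h k = i).card - lam.part i
  -- `α R h` depends on h only through data invariant under permutations of R. The weights f are
  -- chosen so that summing over R ⊇ R₀ gives `lowerCount`, while f t 0 is a binomial coefficient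
  -- covered by `hbin`.
  let f : ℕ → ℕ → ℕ := fun t x => if x ≤ t then (D + t).choose (t - x) else 0
  let α : Finset (Fin r) → (Fin r → Fin n) → ℕ := fun R h =>
    if W h ∧ (∀ k, h k = i → k ∈ R) ∧ (∀ k ∈ R, C (h k)) then f (tt h) (R \ R₀).card else 0
  have hWσ : ∀ h (σ : Equiv.Perm (Fin r)), W h → W (h ∘ σ) := by
    rintro h σ ⟨g, hg, hl⟩
    exact ⟨g ∘ σ, hg.comp σ, fun k => hl (σ k)⟩
  have hid : ∀ h, lam.lowerCount (mu.FirstRow C) i j h =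
      ∑ R ∈ Finset.univ.filter fun R => R₀ ⊆ R, α R h := by
    intro h
    by_cases hW : W h
    swap
    · rw [lam.lowerCount_eq_zero hW]
      exact (Finset.sum_eq_zero fun R _ => if_neg fun hh => hW hh.1).symm
    obtain ⟨t, -, -, hc, hcount⟩ := lam.exists_lowerCount hij hW
    have hci := hc i
    rw [if_neg hij, if_pos rfl, add_zero] at hci
    have htt : tt h = t := by simp only [tt]; omega
    rw [hcount]
    set A := Finset.univ.filter fun k => h k = i with hA
    have hAk : ∀ k, k ∈ A ↔ h k = i := fun k => by simp [hA]
    have hP : ∀ S ∈ Finset.powersetCard t A,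
        (mu.FirstRow C (relabel j h S) ↔ (∀ k ∈ R₀, C (h k)) ∧ A \ S ⊆ R₀) := by
      intro S hS
      have hS' : ∀ k ∈ S, h k = i := fun k hk =>
        (Finset.mem_filter.1 ((Finset.mem_powersetCard.1 hS).1 hk)).2
      rw [FirstRow, and_comm]
      refine and_congr (forall_congr' fun k => ?_) (forall_congr' fun k => ?_)
      · rw [hRrow]
        by_cases hk : k ∈ S
        · rw [relabel_of_mem hk, hS' k hk]; simp [hCi, hCj]
        · rw [relabel_of_notMem hk]
      · rw [hRrow, Finset.mem_sdiff, hAk]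
        by_cases hk : k ∈ S
        · have : ¬ (j : ℕ) = 0 := fun e => hij (Fin.ext (hi.trans e.symm))
          rw [relabel_of_mem hk]; simp [hk, this]
        · rw [relabel_of_notMem hk]; simp [hk, Fin.ext_iff, hi]
    rw [Finset.filter_congr hP]
    by_cases hCR : ∀ k ∈ R₀, C (h k)
    swap
    · rw [Finset.filter_false_of_mem fun _ _ hx => hCR hx.1, Finset.card_empty]
      refine (Finset.sum_eq_zero fun R hR => if_neg fun hh => hCR fun k hk => hh.2.2 k ?_).symm
      exact (Finset.mem_filter.1 hR).2 hk
    rw [Finset.filter_congr (q := fun S => A \ S ⊆ R₀) fun S _ => and_iff_right hCR]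
    rw [hi] at hci
    rw [card_filter_sdiff_subset A R₀ hci]
    set Ch := Finset.univ.filter fun k => C (h k) with hCh
    have hChcard : Ch.card = mu.part 0 + B := by
      obtain ⟨g, ⟨σ, rfl⟩, hl⟩ := hW
      rw [← hB (Finset.univ.filter fun k => C (lam.rowFin k)) (by simp)]
      rw [← card_fiber_comp_perm lam.rowFin σ C]
      congr 1
      refine Finset.filter_congr fun k _ => ?_
      rcases hl k with e | ⟨e, e'⟩
      · simp only [Function.comp_apply] at e; rw [e]
      · simp only [Function.comp_apply] at e'; rw [e, e']; simp [hCi, hCj]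
    have hsub : R₀ ∪ A ⊆ Ch := by
      refine Finset.union_subset (fun k hk => ?_) fun k hk => ?_
      · exact Finset.mem_filter.2 ⟨Finset.mem_univ _, hCR k hk⟩
      · refine Finset.mem_filter.2 ⟨Finset.mem_univ _, ?_⟩
        rw [(hAk k).1 hk]; exact hCi
    set F := Ch \ (R₀ ∪ A) with hF
    have hv : (A \ R₀).card + (A ∩ R₀).card = lam.part 0 + t := by
      rw [Finset.card_sdiff_add_card_inter, hci]
    set v := (A \ R₀).card with hvdef
    have hFcard : F.card + v = B := by
      have h1 : F.card + (R₀ ∪ A).card = Ch.card := Finset.card_sdiff_add_card_eq_card hsub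
      have h2 : (R₀ ∪ A).card = R₀.card + v := by
        rw [← Finset.union_sdiff_self_eq_union,
          Finset.card_union_of_disjoint Finset.disjoint_sdiff]
      omega
    -- Only R with R₀ ∪ A ⊆ R ⊆ Ch contribute; such R arise from R₀ ∪ A by adding any subset E of F.
    have hsum : ∑ R ∈ Finset.univ.filter fun R => R₀ ⊆ R, α R h =
        ∑ E ∈ F.powerset, f t (v + E.card) := by
      rw [← Finset.sum_filter_of_ne (p := fun R => R₀ ∪ A ⊆ R ∧ R ⊆ Ch)]
      · refine Finset.sum_nbij' (fun R => R \ (R₀ ∪ A)) (fun E => (R₀ ∪ A) ∪ E) ?_ ?_ ?_ ?_ ?_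
        · intro R hR
          have := (Finset.mem_filter.1 hR).2
          exact Finset.mem_powerset.2 (Finset.sdiff_subset_sdiff this.2 (le_refl _))
        · intro E hE
          have hE' := Finset.mem_powerset.1 hE
          refine Finset.mem_filter.2 ⟨Finset.mem_filter.2 ⟨Finset.mem_univ _, ?_⟩,
            Finset.subset_union_left, Finset.union_subset hsub (hE'.trans Finset.sdiff_subset)⟩
          exact Finset.subset_union_left.trans Finset.subset_union_left
        · intro R hR
          exact Finset.union_sdiff_of_subset (Finset.mem_filter.1 hR).2.1
        · intro E hE
          have hE' := Finset.mem_powerset.1 hE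
          rw [Finset.union_sdiff_left]
          exact Finset.sdiff_eq_self_of_disjoint
            (Finset.disjoint_of_subset_left hE' Finset.sdiff_disjoint)
        · intro R hR
          have hR' := (Finset.mem_filter.1 hR).2
          have hcond : W h ∧ (∀ k, h k = i → k ∈ R) ∧ (∀ k ∈ R, C (h k)) :=
            ⟨hW, fun k hk => hR'.1 (Finset.mem_union_right _ ((hAk k).2 hk)),
              fun k hk => (Finset.mem_filter.1 (hR'.2 hk)).2⟩
          simp only [α]
          rw [if_pos hcond, htt]
          congr 1
          have h1 : R \ R₀ = (A \ R₀) ∪ (R \ (R₀ ∪ A)) := by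
            ext k
            have := @hR'.1 k
            simp only [Finset.mem_union, Finset.mem_sdiff] at this ⊢
            tauto
          rw [h1, Finset.card_union_of_disjoint]
          rw [Finset.disjoint_left]
          intro k hk hk'
          simp only [Finset.mem_union, Finset.mem_sdiff] at hk hk'
          tauto
      · intro R hR hne
        simp only [α] at hne
        have hcond := (ite_ne_right_iff.1 hne).1
        refine ⟨Finset.union_subset (Finset.mem_filter.1 hR).2 fun k hk =>
          hcond.2.1 k ((hAk k).1 hk), fun k hk => ?_⟩
        exact Finset.mem_filter.2 ⟨Finset.mem_univ _, hcond.2.2 k hk⟩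
    rw [hsum, Finset.sum_powerset_apply_card (fun e => f t (v + e))]
    simp only [smul_eq_mul, f]
    by_cases hvt : v ≤ t
    · have h1 : (A ∩ R₀).card = F.card + (D + t) := by omega
      have h2 : (A ∩ R₀).card.choose (lam.part 0) = (F.card + (D + t)).choose (t - v) := by
        rw [h1]
        exact Nat.choose_symm_of_eq_add (by omega)
      rw [h2, ← sum_choose_mul_choose_sub]
      refine Finset.sum_congr rfl fun e _ => ?_
      congr 1
      refine if_congr (by omega) ?_ rfl
      congr 1; omega
    · rw [Nat.choose_eq_zero_of_lt (by omega)]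
      refine (Finset.sum_eq_zero fun e _ => ?_).symm
      rw [if_neg (by omega), mul_zero]
  have hswap : ∑ h, (lam.lowerCount (mu.FirstRow C) i j h : K) • T h =
      ∑ R ∈ Finset.univ.filter fun R => R₀ ⊆ R, ∑ h, (α R h : K) • T h := by
    rw [Finset.sum_comm]
    refine Finset.sum_congr rfl fun h _ => ?_
    rw [hid, Nat.cast_sum, Finset.sum_smul]
  rw [hswap]
  refine Submodule.sum_mem _ fun R hR => ?_
  have hR' := (Finset.mem_filter.1 hR).2
  by_cases hRR : R = R₀
  · subst hRR
    refine Submodule.sum_mem _ fun h _ => ?_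
    have : (α R₀ h : K) • T h = 0 := by
      simp only [α]
      split_ifs with hcond
      swap
      · rw [Nat.cast_zero, zero_smul]
      obtain ⟨t, -, ht0, hc, -⟩ := lam.exists_lowerCount hij hcond.1
      have hci := hc i
      rw [if_neg hij, if_pos rfl, add_zero] at hci
      have htt : tt h = t := by simp only [tt]; omega
      rcases Nat.eq_zero_or_pos t with h0 | hpos
      · rw [(ht0 h0).family_eq_zero hT hT0, smul_zero]
      -- All `lam.part 0 + t` labels i lie in the first row, so t ≤ d and `hbin` applies.
      have hle : (Finset.univ.filter fun k => h k = i).card ≤ R₀.card :=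
        Finset.card_le_card fun k hk => hcond.2.1 k (Finset.mem_filter.1 hk).2
      rw [hci, hRcard, hi] at hle
      rw [htt, Finset.sdiff_self, Finset.card_empty]
      simp only [f]
      rw [if_pos (Nat.zero_le _), Nat.sub_zero, hbin t hpos (by omega), zero_smul]
    rw [this]
    exact Submodule.zero_mem _
  -- A larger R contains a place l below the first row together with the first-row place k of the
  -- same column; its inner sum is symmetric in k and l.
  · obtain ⟨l, hlR, hl⟩ : ∃ l ∈ R, l ∉ R₀ := by
      by_contra! hcon
      exact hRR (Finset.Subset.antisymm hcon hR')
    have hcl : mu.col l < mu.part i := (mu.col_lt l).trans_le (mu.antitone (by rw [hi]; omega))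
    obtain ⟨k, hk, hkl⟩ := mu.exists_box i hcl
    have hkR : k ∈ R := hR' (by simp [hR₀, hk])
    have hne : k ≠ l := by
      rintro rfl
      exact hl (by simp [hR₀, hk])
    refine mem_alternatingRelations_of_swap hne hkl ?_
    rw [map_sum]
    refine Fintype.sum_equiv (Equiv.arrowCongr (Equiv.swap k l) (Equiv.refl _)) _ _ fun h => ?_
    have hh : (Equiv.arrowCongr (Equiv.swap k l) (Equiv.refl _)) h = h ∘ (Equiv.swap k l) := rfl
    have hmemR : ∀ m, Equiv.swap k l m ∈ R ↔ m ∈ R := fun m => by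
      have := apply_swap_of_eq (f := fun m => m ∈ R) (k := k) (l := l)
        (by simp only [hkR, hlR]) m
      exact iff_of_eq this
    rw [map_smul, hT, Equiv.symm_swap, hh]
    congr 2
    simp only [α]
    have ht : tt (h ∘ Equiv.swap k l) = tt h := by
      simp only [tt, Function.comp_apply]
      rw [card_fiber_comp_perm h (Equiv.swap k l) (· = i)]
    rw [ht]
    refine if_congr (and_congr ⟨hWσ h _, fun hw => ?_⟩ (and_congr ?_ ?_)) rfl rfl
    · have := hWσ _ (Equiv.swap k l) hw
      rwa [Function.comp_assoc, ← Equiv.Perm.coe_mul, Equiv.swap_mul_self, Equiv.Perm.coe_one,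
        Function.comp_id] at this
    · rw [← (Equiv.swap k l).forall_congr_right (q := fun m => h m = i → m ∈ R)]
      simp only [hmemR, Function.comp_apply]
    · rw [← (Equiv.swap k l).forall_congr_right (q := fun m => m ∈ R → C (h m))]
      simp only [hmemR, Function.comp_apply]

end PartitionOf

end

/-! ### The two homomorphisms and their linear independence -/

noncomputable section

lemma cast_choose_eq_zero_of_dvd_binomGcd {K : Type*} [Field K] {p : ℕ} [CharP K p] {x y : ℕ}
    (h : p ∣ binomGcd (x + 1) y) {t : ℕ} (h1 : 1 ≤ t) (h2 : t ≤ y) :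
    (((x + t).choose t : ℕ) : K) = 0 := by
  rw [CharP.cast_eq_zero_iff K p]
  have := h.trans (Finset.gcd_dvd (f := fun i => (x + 1 + i - 1).choose i)
    (Finset.mem_Icc.2 ⟨h1, h2⟩))
  rwa [show x + 1 + t - 1 = x + t by omega] at this

lemma two_le_rank_of_pair {K M : Type*} [Field K] [AddCommGroup M] [Module K M] (f g : M)
    (h : ∀ s t : K, s • f + t • g = 0 → s = 0 ∧ t = 0) : 2 ≤ Module.rank K M := by
  have hli : LinearIndependent K ![f, g] := LinearIndependent.pair_iff.2 h
  simpa using hli.cardinal_lift_le_rank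

namespace PartitionOf

variable {n r : ℕ} (lam mu : PartitionOf n r) {K : Type*} [Field K]

lemma val_eq_sum_add_col (k : Fin r) :
    (k : ℕ) = ∑ i ∈ Finset.range (lam.row k), lam.part i + lam.col k := by
  have h1 : finSigmaFinEquiv (lam.box k) = finCongr lam.sum_eq.symm k := by simp [box]
  have h2 := congrArg Fin.val h1
  rw [finSigmaFinEquiv_apply] at h2
  rw [← Fin.sum_univ_eq_sum_range]
  exact h2.symm

lemma row_eq_zero_iff (k : Fin r) : lam.row k = 0 ↔ (k : ℕ) < lam.part 0 := by
  have h := lam.val_eq_sum_add_col k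
  constructor
  · intro h0
    have := lam.col_lt k
    rw [← row_eq, h0] at this
    rw [h0] at h
    simp at h
    omega
  · intro hk
    by_contra hne
    have := Finset.single_le_sum (f := lam.part) (fun _ _ => Nat.zero_le _)
      (Finset.mem_range.2 (Nat.pos_of_ne_zero hne))
    omega

lemma row_le_one_iff (k : Fin r) : lam.row k ≤ 1 ↔ (k : ℕ) < lam.part 0 + lam.part 1 := by
  have h := lam.val_eq_sum_add_col k
  constructor
  · intro h1
    rcases Nat.le_one_iff_eq_zero_or_eq_one.1 h1 with h0 | h0
    · have := (lam.row_eq_zero_iff k).1 h0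
      omega
    · have := lam.col_lt k
      rw [← row_eq, h0] at this
      rw [h0, Finset.sum_range_one] at h
      omega
  · intro hk
    by_contra! hne
    have := Finset.sum_le_sum_of_subset (f := lam.part)
      (Finset.range_mono (show 2 ≤ lam.row k from hne))
    rw [Finset.sum_range_succ, Finset.sum_range_one] at this
    omega

lemma spreadMap_mem_of_mem_relations {P : (Fin r → Fin n) → Prop}
    (H : ∀ (i j : Fin n) (T : (Fin r → Fin n) → TensorSpace K n r), (j : ℕ) = i + 1 →
      IsFamily T → T lam.rowFin = 0 → ∑ h, (lam.lowerCount P i j h : K) • T h ∈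
        alternatingRelations (K := K) (n := n) mu.col) :
    ∀ x ∈ lam.relations K,
      lam.spreadMap K P x ∈ alternatingRelations (K := K) (n := n) mu.col := by
  intro x hx
  induction hx using Submodule.span_induction with
  | zero => rw [map_zero]; exact Submodule.zero_mem _
  | add x y _ _ hx hy => rw [map_add]; exact Submodule.add_mem _ hx hy
  | smul a x _ hx =>
    rw [LinearMap.map_smul_of_tower]
    exact smul_mem_alternatingRelations a hx
  | mem y hy =>
    obtain ⟨i, j, T, hij, hT, hT0, rfl⟩ := hy
    rw [lam.sum_famAct_transvection P (fun h => by rw [h] at hij; omega) hT]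
    exact H i j T hij hT hT0

open Classical in
/-- The coefficient of a suitable semistandard word in the image of the generator of `Δ(λ)`. -/
lemma columnForm_spreadMap (hmu : ∀ i, 2 ≤ i → mu.part i = 0) (C : Fin n → Prop)
    {u : Fin r → Fin n} (hu : lam.HasContent u)
    (hu0 : ∀ k, mu.row k = 0 → mu.col k < mu.part 1 → (u k : ℕ) = 0) :
    columnForm mu.col u (lam.spreadMap K (mu.FirstRow C) (wordBasis K n r lam.rowFin)) =
      if mu.FirstRow C u then 1 else 0 := by
  have hfam : IsFamily (fun g : Fin r → Fin n => wordBasis K n r g) :=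
    fun σ h => placePerm_wordBasis σ h
  rw [lam.spreadMap_family (mu.FirstRow C) hfam]
  have hrepr : ∀ w, (wordBasis K n r).repr
      (∑ g, if lam.HasContent g ∧ mu.FirstRow C g then wordBasis K n r g else 0) w =
      if lam.HasContent w ∧ mu.FirstRow C w then 1 else 0 := by
    intro w
    rw [map_sum, Finsupp.finsetSum_apply, Finset.sum_eq_single w]
    · split_ifs <;> simp
    · intro g _ hg
      split_ifs <;> simp [hg]
    · simp
  rw [columnForm_apply, Finset.sum_eq_single 1]
  · rw [hrepr]
    simp [hu]
  · intro τ _ hτ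
    rw [hrepr]
    split_ifs with hcol hP
    · exfalso
      have hrow : ∀ k, mu.row k ≠ 0 → mu.row k = 1 := by
        intro k hk
        by_contra h1
        have := mu.col_lt k
        rw [← row_eq, hmu (mu.row k) (by omega)] at this
        omega
      have h1 : ∀ k, mu.row k ≠ 0 → τ k = k := by
        intro k hk
        by_contra hne
        have hτk : mu.row (τ k) = 0 := by
          by_contra h0
          exact hne (mu.box_injective (Fin.ext ((hrow _ h0).trans (hrow _ hk).symm)) (hcol k))
        refine hk (hP.2.1 k (hu0 _ hτk ?_))
        rw [hcol]
        have := mu.col_lt k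
        rwa [← row_eq, hrow k hk] at this
      refine hτ (Equiv.ext fun k => ?_)
      rw [Equiv.Perm.one_apply]
      by_cases hk : mu.row k = 0
      · by_cases hτk : mu.row (τ k) = 0
        · exact mu.box_injective (Fin.ext (hτk.trans hk.symm)) (hcol k)
        · exact τ.injective (h1 _ hτk)
      · exact h1 k hk
    · rw [mul_zero]
    · rfl
  · simp

end PartitionOf

end

theorem corollary6p2 (K : Type*) [Field K] [Infinite K] (p : ℕ) (hp : 0 < p) [CharP K p]
    (n r : ℕ) (hn : r ≤ n) (lam mu : PartitionOf n r)
    -- `lam` has exactly `m` nonzero parts, `m ≥ 3`, and `mu` has at most two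
    (m : ℕ) (hm : 3 ≤ m) (hlam : ∀ i, lam.part i ≠ 0 ↔ i < m)
    (hmu : ∀ i, 2 ≤ i → mu.part i = 0)
    (hle : mu.part 1 ≤ lam.part 0)
    (d : ℕ) (hd : mu.part 0 = lam.part 0 + d) (hd0 : 0 < d)
    (hd1 : d ≤ lam.part 1 - lam.part 2)
    (h1 : p ∣ binomGcd (lam.part 0 - mu.part 1 + 1) d)
    (h2 : ∀ i, 1 ≤ i → i + 1 < m → p ∣ binomGcd (lam.part i + 1) (lam.part (i + 1)))
    (h3 : p ∣ binomGcd (lam.part 0 - lam.part 1 + d + 1) d)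
    (h4 : p ∣ binomGcd (lam.part 1 - d + 1) (lam.part 2)) :
    2 ≤ Module.rank K (lam.weyl K →ₗ[SchurAlgebra K n r] mu.weyl K) := by
  classical
  have hn3 : 3 ≤ n := by
    by_contra! hlt
    exact (hlam 2).2 (by omega) (lam.part_eq_zero 2 (by omega))
  have hl10 : lam.part 1 ≤ lam.part 0 := lam.antitone (by omega)
  have hl2 : lam.part 2 ≠ 0 := (hlam 2).2 (by omega)
  have hr : r = mu.part 0 + mu.part 1 := by
    have hsum := mu.sum_eq
    rw [Fin.sum_univ_eq_sum_range,
      ← Finset.sum_subset (Finset.range_mono (show 2 ≤ n by omega)) fun i _ hi =>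
        hmu i (by simpa [Nat.lt_iff_add_one_le] using hi),
      Finset.sum_range_succ, Finset.sum_range_one] at hsum
    exact hsum.symm
  have hrl : lam.part 0 + lam.part 1 + lam.part 2 ≤ r := by
    have hsum := lam.sum_eq
    rw [Fin.sum_univ_eq_sum_range] at hsum
    refine le_trans (le_of_eq ?_) (le_of_le_of_eq (b := ∑ i ∈ Finset.range n, lam.part i)
      (Finset.sum_le_sum_of_subset (Finset.range_mono hn3)) hsum)
    rw [Finset.sum_range_succ, Finset.sum_range_succ, Finset.sum_range_one]
  let z : Fin n := ⟨0, by omega⟩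
  let o : Fin n := ⟨1, by omega⟩
  have hzo : z ≠ o := fun h => absurd (congrArg Fin.val h) (by simp [z, o])
  let C₁ : Fin n → Prop := fun _ => True
  let C₂ : Fin n → Prop := fun c => c = z ∨ c = o
  have hlower : ∀ i : ℕ, i ≠ 0 → ∀ t, 1 ≤ t → t ≤ lam.part (i + 1) →
      (((lam.part i + t).choose t : ℕ) : K) = 0 := by
    intro i hi t ht ht'
    refine cast_choose_eq_zero_of_dvd_binomGcd (h2 i (by omega) ?_) ht ht'
    exact (hlam (i + 1)).1 (by omega)
  obtain ⟨Ψ₁, hΨ₁⟩ := lam.exists_hom (K := K) mu (P := mu.FirstRow C₁)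
    (fun τ hτ g => mu.firstRow_comp C₁ hτ g) (lam.spreadMap_mem_of_mem_relations mu (by
      intro i j T hij hT hT0
      have hne : i ≠ j := fun h => by rw [h] at hij; omega
      by_cases hi : (i : ℕ) = 0
      -- All r places are admissible, so the excess B over the first row is `mu.part 1`, and D is
      -- the number in `h1`.
      · refine lam.sum_lowerCount_mem mu hi hne trivial trivial hd (B := mu.part 1)
          (D := lam.part 0 - mu.part 1) ?_ (by omega) ?_ hT hT0
        · intro h hh
          rw [Finset.eq_univ_iff_forall.2 fun k => (hh k).2 trivial, Finset.card_univ,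
            Fintype.card_fin, ← hr]
        · exact fun t ht ht' => cast_choose_eq_zero_of_dvd_binomGcd h1 ht ht'
      · refine Submodule.sum_mem _ fun h _ => ?_
        rw [lam.lowerCount_smul_eq_zero mu hne hi (by omega) Iff.rfl
          (by rw [hij]; exact hlower i hi) hT hT0]
        exact Submodule.zero_mem _))
  obtain ⟨Ψ₂, hΨ₂⟩ := lam.exists_hom (K := K) mu (P := mu.FirstRow C₂)
    (fun τ hτ g => mu.firstRow_comp C₂ hτ g) (lam.spreadMap_mem_of_mem_relations mu (by
      intro i j T hij hT hT0
      have hne : i ≠ j := fun h => by rw [h] at hij; omega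
      by_cases hi : (i : ℕ) = 0
      · have hiz : i = z := Fin.ext hi
        have hjo : j = o := Fin.ext (by rw [hij, hi])
        refine lam.sum_lowerCount_mem mu hi hne (Or.inl hiz) (Or.inr hjo) hd
          (B := lam.part 1 - d) (D := lam.part 0 - (lam.part 1 - d)) ?_ (by omega) ?_ hT hT0
        · intro h hh
          have hset : h = (Finset.univ.filter fun k => lam.rowFin k = z) ∪
              Finset.univ.filter fun k => lam.rowFin k = o := by
            ext k
            simp [hh, C₂]
          rw [hset, Finset.card_union_of_disjoint, lam.card_rowFin, lam.card_rowFin]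
          · simp only [z, o]
            omega
          · rw [Finset.disjoint_left]
            intro k hk hk'
            exact hzo ((Finset.mem_filter.1 hk).2.symm.trans (Finset.mem_filter.1 hk').2)
        · intro t ht ht'
          rw [show lam.part 0 - (lam.part 1 - d) = lam.part 0 - lam.part 1 + d by omega]
          exact cast_choose_eq_zero_of_dvd_binomGcd h3 ht ht'
      · refine Submodule.sum_mem _ fun h _ => ?_
        by_cases hi1 : (i : ℕ) = 1
        · have hio : i = o := Fin.ext hi1
          rw [lam.lowerCount_smul_eq_zero_of_boundary mu (z := z) rfl hne hi (by omega)
            (fun c => by rw [hio]) hd (by rw [hi1]; omega) (by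
              rw [hij, hi1]
              exact fun t ht ht' => cast_choose_eq_zero_of_dvd_binomGcd h4 ht ht') hT hT0]
          exact Submodule.zero_mem _
        · have hC : ∀ c : Fin n, 2 ≤ (c : ℕ) → ¬ C₂ c := by
            rintro c hc (rfl | rfl)
            · simp [z] at hc
            · simp [o] at hc
          rw [lam.lowerCount_smul_eq_zero mu hne hi (by omega)
            (iff_of_false (hC i (by omega)) (hC j (by omega)))
            (by rw [hij]; exact hlower i hi) hT hT0]
          exact Submodule.zero_mem _))
  -- the two words that separate the homomorphisms
  have hx₀ : wordBasis K n r lam.rowFin ∈ dividedPowers (K := K) (n := n) lam.row := by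
    intro σ hσ
    rw [placePerm_wordBasis]
    congr 1
    funext k
    have := hσ (σ.symm k)
    rw [Equiv.apply_symm_apply] at this
    exact Fin.ext this.symm
  -- a is the last place of the first row of μ, labelled 1; b is the first place labelled 2, below
  -- that row because d ≤ `lam.part 1`. Exchanging them brings a label 2 into the first row, which
  -- `C₁` allows and `C₂` forbids.
  let a : Fin r := ⟨lam.part 0 + d - 1, by omega⟩
  let b : Fin r := ⟨lam.part 0 + lam.part 1, by omega⟩
  have ha : mu.row a = 0 := (mu.row_eq_zero_iff a).2 (by simp only [a]; omega)
  have hb : mu.row b ≠ 0 := fun h => by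
    have := (mu.row_eq_zero_iff b).1 h
    simp only [b] at this
    omega
  have hla : lam.row a ≠ 0 := fun h => by
    have := (lam.row_eq_zero_iff a).1 h
    simp only [a] at this
    omega
  have hlb : ¬ lam.row b ≤ 1 := fun h => by
    have := (lam.row_le_one_iff b).1 h
    simp only [b] at this
    omega
  have hfirst : ∀ k, mu.row k = 0 → mu.col k < mu.part 1 → lam.row k = 0 := by
    intro k hk hk'
    have := mu.val_eq_sum_add_col k
    rw [hk, Finset.range_zero, Finset.sum_empty, zero_add] at this
    exact (lam.row_eq_zero_iff k).2 (by omega)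
  have hrow0 : ∀ k, lam.row k = 0 → mu.row k = 0 := by
    intro k hk
    have := (lam.row_eq_zero_iff k).1 hk
    exact (mu.row_eq_zero_iff k).2 (by omega)
  set u : Fin r → Fin n := lam.rowFin ∘ Equiv.swap a b with hu
  have hu0 : ∀ k, lam.row k = 0 → u k = lam.rowFin k := by
    intro k hk
    rw [hu, Function.comp_apply, Equiv.swap_apply_of_ne_of_ne]
    · rintro rfl; exact hla hk
    · rintro rfl; exact hb (hrow0 _ hk)
  have hu1 : mu.FirstRow C₁ u := by
    refine ⟨fun k hk => ?_, fun _ _ => trivial⟩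
    rw [hu, Function.comp_apply] at hk
    by_cases hka : k = a
    · rw [hka]; exact ha
    by_cases hkb : k = b
    · rw [hkb, Equiv.swap_apply_right] at hk
      exact absurd hk hla
    · rw [Equiv.swap_apply_of_ne_of_ne hka hkb] at hk
      exact hrow0 k hk
  have hu2 : ¬ mu.FirstRow C₂ u := by
    intro h
    have h5 := h.2 a ha
    rw [hu, Function.comp_apply, Equiv.swap_apply_left] at h5
    rcases h5 with h5 | h5
    · exact hlb (by rw [PartitionOf.row_eq, h5]; simp [z])
    · exact hlb (by rw [PartitionOf.row_eq, h5])
  have hw2 : mu.FirstRow C₂ lam.rowFin := by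
    refine ⟨hrow0, fun k hk => ?_⟩
    have h5 := (mu.row_eq_zero_iff k).1 hk
    have h6 : lam.row k ≤ 1 := (lam.row_le_one_iff k).2 (by omega)
    rcases Nat.le_one_iff_eq_zero_or_eq_one.1 h6 with h7 | h7
    · exact Or.inl (Fin.ext h7)
    · exact Or.inr (Fin.ext h7)
  have hli : ∀ s t : K, s • Ψ₁ + t • Ψ₂ = 0 → s = 0 ∧ t = 0 := by
    intro s t hst
    have hmem : s • lam.spreadMap K (mu.FirstRow C₁) (wordBasis K n r lam.rowFin) +
        t • lam.spreadMap K (mu.FirstRow C₂) (wordBasis K n r lam.rowFin) ∈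
          alternatingRelations (K := K) (n := n) mu.col := by
      rw [← Submodule.Quotient.mk_eq_zero, Submodule.Quotient.mk_add,
        Submodule.Quotient.mk_smul, Submodule.Quotient.mk_smul]
      have h5 := congrArg (fun v : mu.weyl K => (v : exteriorPowers K n mu.col))
        (LinearMap.congr_fun hst (lam.toWeyl K ⟨_, hx₀⟩))
      have h6 := hΨ₁ ⟨_, hx₀⟩
      have h7 := hΨ₂ ⟨_, hx₀⟩
      rw [Submodule.mkQ_apply] at h6 h7
      rw [← h6, ← h7]
      exact h5
    have hform : ∀ v : Fin r → Fin n, lam.HasContent v → (∀ k, lam.row k = 0 → v k = lam.rowFin k) →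
        s * (if mu.FirstRow C₁ v then 1 else 0) + t * (if mu.FirstRow C₂ v then 1 else 0) = 0 := by
      intro v hv hv0
      have h5 := columnForm_eq_zero v hmem
      have h6 : ∀ k, mu.row k = 0 → mu.col k < mu.part 1 → (v k : ℕ) = 0 := fun k hk hk' => by
        have h7 := hfirst k hk hk'
        rw [hv0 k h7, ← PartitionOf.row_eq, h7]
      rwa [map_add, map_smul, map_smul, lam.columnForm_spreadMap mu hmu C₁ hv h6,
        lam.columnForm_spreadMap mu hmu C₂ hv h6, smul_eq_mul, smul_eq_mul] at h5
    -- The system is triangular: u sees only Ψ₁, and `lam.rowFin` then isolates t.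
    have hs : s = 0 := by
      have := hform u ⟨_, rfl⟩ hu0
      rwa [if_pos hu1, if_neg hu2, mul_one, mul_zero, add_zero] at this
    have ht : t = 0 := by
      have := hform lam.rowFin ⟨1, rfl⟩ fun _ _ => rfl
      rwa [hs, zero_mul, zero_add, if_pos hw2, mul_one] at this
    exact ⟨hs, ht⟩
  exact two_le_rank_of_pair Ψ₁ Ψ₂ hli
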